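/- An (abstract) decorated Gauss diagram $G^d$ consists of two finite families $\mathcal M^+$, $\mathcal M^-$ of $g^+$ and $g^-$ oriented circles ($g^+\ne g^-$ is allowed), finitely many chords with signs $\pm$, each joining a circle of $\mathcal M^+$ to a circle of $\mathcal M^-$ (at distinct end points), and a coloring, described below. The edges of a circle are the arcs between consecutive chord ends, or the whole circle if it carries no chord. Gluing the annuli $\mathcal M^\pm\times[-1,1]$ crosswise along one square for each chord, so that the two cores cross with the sign of the chord, gives an oriented ribbon surface, the ribbon graph of the diagram. Its boundary components are called cycles. The edge pair $(c_1,c_2)$ of an edge consists of the cycle that runs along its right side and the cycle that runs along its left side. If at a chord $(a_1,a_2),(b_1,b_2)$ are the pairs of the incoming and outgoing edge of $\mathcal M^+$ and $(c_1,c_2),(d_1,d_2)$ those of $\mathcal M^-$, then $(a_1,a_2,b_1,b_2)=(c_2,d_2,c_1,d_1)$ if the chord is positive and $(a_1,a_2,b_1,b_2)=(d_1,c_1,d_2,c_2)$ if it is negative. The coloring assigns to each cycle a color from a finite set, all of whose elements are used. The closed oriented surface $S(G^d)$ is obtained from the ribbon graph by taking, for each color, a sphere with as many holes as there are cycles of this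 color and gluing it to these cycles. The genus $g_{S(G^d)}$ is defined by $\chi(S(G^d))=2-2g_{S(G^d)}$ (this is the usual genus if $S(G^d)$ is connected; $S(G^d)$ is not assumed to be connected). For each of the two signs, let $H^\pm$ be the compression body obtained from $S(G^d)\times[-1,1]$ by attaching 2-handles along the curves $\mathcal M^\pm\times\{-1\}$ and then filling with 3-balls all spherical boundary components other than those of the outer boundary $\partial^+H^\pm=S(G^d)\times\{1\}$. Let $\partial^-H^\pm=\partial H^\pm-\partial^+H^\pm$ be its inner boundary, and let $\partial g^\pm$ be the sum of the genera of the connected components of $\partial^-H^\pm$. Let $C^\pm$ be the graph whose vertices are the colors, in which $p$ and $q$ are joined if an edge (or a circle without chords) of the other family $\mathcal M^\mp$ has cycles of colors $p$ and $q$ on its two sides, and let $k^\pm$ be the number of connected components of $C^\pm$. **Proposition.** For every decorated Gauss diagram $G^d$ and each of the two signs, $$\partial g^\pm = k^\pm-g^\pm+g_{S(G^d)}-1 .$$ Moreover, the connected components of $C^\pm$ correspond bijectively to the connected components of $S(G^d)-\mathcal M^\pm$: the component of a color $c$ corresponds to the component that contains the sphere with holes of color $c$. -/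

import Mathlib

/-! ## Finite cell complexes -/

/-- A finite cell complex, recorded by its open cells, their dimensions, and for every cell `a` and
every cell `b` of one dimension less the number `mult a b` of times that the boundary of `a` runs
over `b`. -/
structure CellComplex where
  Cell : Type
  finite : Finite Cell
  dim : Cell → ℕ
  mult : Cell → Cell → ℕ
  codim_one : ∀ a b, mult a b ≠ 0 → dim a = dim b + 1

namespace CellComplex

attribute [instance] CellComplex.finite

/-- The Euler characteristic of a set of cells: the alternating number of its cells. -/
noncomputable def eulerChar (X : CellComplex) (B : Set X.Cell) : ℤ :=
  ∑ᶠ a ∈ B, (-1 : ℤ) ^ X.dim a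

/-- The genus of a closed oriented surface, given by `χ = 2 - 2 * genus`. -/
noncomputable def genus (X : CellComplex) (B : Set X.Cell) : ℚ :=
  1 - (X.eulerChar B : ℚ) / 2

/-- The connected components of a union `A` of open cells. It is used for sets `A` that are open or
closed (or a difference of such), where two cells of `A`, one in the closure of the other, are
always joined through cells of `A` by steps of codimension one. -/
def Component (X : CellComplex) (A : Set X.Cell) : Type :=
  Quot fun a b : A => X.mult a b ≠ 0

/-- The component of `A` that contains the cell `a`. -/
def componentOf (X : CellComplex) (A : Set X.Cell) (a : A) : X.Component A :=
  Quot.mk _ a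

/-- The set of the cells of a component. -/
def cellsOf (X : CellComplex) {A : Set X.Cell} (K : X.Component A) : Set X.Cell :=
  {a | ∃ h : a ∈ A, X.componentOf A ⟨a, h⟩ = K}

/-- The boundary of a compact 3-manifold: the 2-cells over which the 3-cells run exactly once in
total, together with all cells in their closures. -/
def boundary (X : CellComplex) : Set X.Cell :=
  {a | ∃ f, X.dim f = 2 ∧ ∑ᶠ b, X.mult b f = 1 ∧
    Relation.ReflTransGen (fun c d => X.mult c d ≠ 0) f a}

open Classical in
/-- Glue a 3-ball to every spherical component of the union `A` of boundary components. -/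
noncomputable def fillSpheres (X : CellComplex) (A : Set X.Cell) : CellComplex where
  Cell := X.Cell ⊕ {K : X.Component A // X.eulerChar (X.cellsOf K) = 2}
  finite := by
    have : Finite (X.Component A) := Quot.finite _
    infer_instance
  dim := Sum.elim X.dim fun _ => 3
  mult a b := match a, b with
    | .inl a, .inl b => X.mult a b
    | .inr K, .inl b => if b ∈ X.cellsOf K.1 ∧ X.dim b = 2 then 1 else 0
    | _, .inr _ => 0
  codim_one := by
    rintro (a | K) (b | L) h
    · exact X.codim_one _ _ h
    · exact absurd rfl h
    · dsimp only at h
      split_ifs at h with h1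
      · simp [h1.2]
      · exact absurd rfl h
    · exact absurd rfl h

end CellComplex

/-! An interval that is divided into `m` parts has the cells `0, …, 2 m`: the even numbers are its
vertices, in order, and the odd number `i` is the edge from the vertex `i - 1` to the vertex
`i + 1`. -/

/-- The dimension of a cell of a divided interval. -/
def segDim {n : ℕ} (i : Fin n) : ℕ := i.val % 2

/-- The incidences of the cells of a divided interval. -/
def segMult {n : ℕ} (i j : Fin n) : ℕ :=
  if i.val % 2 = 1 ∧ (i.val = j.val + 1 ∨ j.val = i.val + 1) then 1 else 0

/-- The incidences of the product of two divided intervals. -/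
def squareMult {n : ℕ} (p q : Fin n × Fin n) : ℕ :=
  (if p.2 = q.2 then segMult p.1 q.1 else 0) + (if p.1 = q.1 then segMult p.2 q.2 else 0)

theorem segMult_codim_one {n : ℕ} (i j : Fin n) (h : segMult i j ≠ 0) :
    segDim i = segDim j + 1 := by
  unfold segMult at h
  unfold segDim
  split_ifs at h with h1
  · omega
  · exact absurd rfl h

theorem squareMult_codim_one {n : ℕ} (p q : Fin n × Fin n) (h : squareMult p q ≠ 0) :
    segDim p.1 + segDim p.2 = segDim q.1 + segDim q.2 + 1 := by
  unfold squareMult at h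
  have : (p.2 = q.2 ∧ segMult p.1 q.1 ≠ 0) ∨ (p.1 = q.1 ∧ segMult p.2 q.2 ≠ 0) := by
    by_contra hn
    push Not at hn
    apply h
    split_ifs with h1 h2 h2 <;> simp_all
  rcases this with ⟨h1, h2⟩ | ⟨h1, h2⟩
  · have := segMult_codim_one _ _ h2
    rw [h1]
    omega
  · have := segMult_codim_one _ _ h2
    rw [h1]
    omega

/-! ## Gauss diagrams -/

/-- A sign: of a chord, or of one of the two families of circles. -/
inductive PM where
  | plus
  | minus
  deriving DecidableEq

/-- The opposite sign. -/
def PM.opp : PM → PM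
  | .plus => .minus
  | .minus => .plus

instance : Finite PM :=
  Finite.of_surjective (fun b : Bool => if b then PM.plus else PM.minus) (by
    rintro (_ | _)
    · exact ⟨true, rfl⟩
    · exact ⟨false, rfl⟩)

/-- The two sides of an oriented curve on an oriented surface. -/
inductive LR where
  | left
  | right
  deriving DecidableEq

instance : Finite LR :=
  Finite.of_surjective (fun b : Bool => if b then LR.left else LR.right) (by
    rintro (_ | _)
    · exact ⟨true, rfl⟩
    · exact ⟨false, rfl⟩)

/-- An (abstract) Gauss diagram: two families of `g plus` and `g minus` oriented circles, and `n`
signed chords, each of which joins a circle of the family `plus` to a circle of the family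
`minus`. -/
structure GaussDiagram where
  /-- the number of circles of each family -/
  g : PM → ℕ
  /-- the number of chords -/
  n : ℕ
  /-- the sign of a chord -/
  sign : Fin n → PM
  /-- the circle of the family `s` on which the chord ends -/
  circ : (s : PM) → Fin n → Fin (g s)
  /-- the chord whose end comes next along the oriented circle of the family `s` -/
  next : (s : PM) → Equiv.Perm (Fin n)
  /-- the ends on one circle form one cyclic sequence -/
  circ_eq_iff : ∀ s h k, circ s h = circ s k ↔ (next s).SameCycle h k

namespace GaussDiagram

variable (G : GaussDiagram)

/-- The circles of the family `s` without chords. -/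
abbrev Bubble (s : PM) : Type := {i : Fin (G.g s) // ∀ h, G.circ s h ≠ i}

/-- The edges of the family `s`: `Sum.inl h` is the arc of a circle that starts at the end of the
chord `h`, and `Sum.inr i` is a whole circle without chords. -/
abbrev Edge (s : PM) : Type := Fin G.n ⊕ G.Bubble s

/-- The circle that contains an edge. -/
def circleOf (s : PM) : G.Edge s → Fin (G.g s)
  | .inl h => G.circ s h
  | .inr i => i.1

/-- The following edge on the same circle. -/
def nextEdge (s : PM) : G.Edge s → G.Edge s
  | .inl h => .inl (G.next s h)
  | .inr i => .inr i

/-- The edge of the family `s` that comes in at the chord `h`. -/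
def incoming (s : PM) (h : Fin G.n) : G.Edge s := .inl ((G.next s).symm h)

/-- The edge of the family `s` that goes out at the chord `h`. -/
def outgoing (s : PM) (h : Fin G.n) : G.Edge s := .inl h

/-- An edge with one of its two sides: an arc in the boundary of the ribbon graph. -/
abbrev Side : Type := Σ s : PM, G.Edge s × LR

/-- The first entry of the pair of an edge: the boundary arc on its right side, which has the
direction of the edge. -/
def fst {s : PM} (e : G.Edge s) : G.Side := ⟨s, e, .right⟩

/-- The second entry of the pair of an edge: the boundary arc on its left side. -/
def snd {s : PM} (e : G.Edge s) : G.Side := ⟨s, e, .left⟩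

/-- The right turn rule. If `(a₁, a₂)` and `(b₁, b₂)` belong to the incoming and the outgoing edge
of the family `plus` at a chord, and `(c₁, c₂)` and `(d₁, d₂)` to those of the family `minus`, then
`(a₁, a₂, b₁, b₂)` is identified with `(c₂, d₂, c₁, d₁)` at a positive chord and with
`(d₁, c₁, d₂, c₂)` at a negative one. -/
inductive Turn : G.Side → G.Side → Prop
  | pos_a₁ (h) : G.sign h = .plus →
      Turn (G.fst (G.incoming .plus h)) (G.snd (G.incoming .minus h))
  | pos_a₂ (h) : G.sign h = .plus →
      Turn (G.snd (G.incoming .plus h)) (G.snd (G.outgoing .minus h))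
  | pos_b₁ (h) : G.sign h = .plus →
      Turn (G.fst (G.outgoing .plus h)) (G.fst (G.incoming .minus h))
  | pos_b₂ (h) : G.sign h = .plus →
      Turn (G.snd (G.outgoing .plus h)) (G.fst (G.outgoing .minus h))
  | neg_a₁ (h) : G.sign h = .minus →
      Turn (G.fst (G.incoming .plus h)) (G.fst (G.outgoing .minus h))
  | neg_a₂ (h) : G.sign h = .minus →
      Turn (G.snd (G.incoming .plus h)) (G.fst (G.incoming .minus h))
  | neg_b₁ (h) : G.sign h = .minus →
      Turn (G.fst (G.outgoing .plus h)) (G.snd (G.outgoing .minus h))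
  | neg_b₂ (h) : G.sign h = .minus →
      Turn (G.snd (G.outgoing .plus h)) (G.snd (G.incoming .minus h))

/-- The cycles of a Gauss diagram, i.e. the boundary components of its ribbon graph. -/
def Cycle : Type := Quot G.Turn

end GaussDiagram

/-- A decorated Gauss diagram: each cycle has one of the `m` colors, and all colors are used. -/
structure DecoratedGaussDiagram extends GaussDiagram where
  /-- the number of colors -/
  m : ℕ
  color : toGaussDiagram.Cycle → Fin m
  color_surjective : Function.Surjective color

namespace DecoratedGaussDiagram

variable (G : DecoratedGaussDiagram)

/-- The color of the cycle through a side of an edge. -/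
def sideColor (x : G.Side) : Fin G.m := G.color (Quot.mk _ x)

/-- The color graph `C^s`: its vertices are the colors, and each edge or circle without chords of
the other family joins the two colors in its pair. -/
def colorGraph (s : PM) : SimpleGraph (Fin G.m) :=
  SimpleGraph.fromRel fun p q =>
    ∃ e : G.Edge s.opp, G.sideColor (G.fst e) = p ∧ G.sideColor (G.snd e) = q

/-- The number `k^s` of the connected components of the color graph. -/
noncomputable def k (s : PM) : ℕ := Nat.card (G.colorGraph s).ConnectedComponent

/-! ## The surface of a decorated Gauss diagram

The annulus around a circle is the product of the circle with `[-1, 1]`, and `[-1, 1]` is divided in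
two by `0`; its cells are `0, …, 4`, with `2` the cell of the core. The coordinate
`t` across an annulus runs from the left side `0` to the right side `4` of the circle. -/

/-- The cells of the surface `S(G)`.
* `coupon h i j`: the square `[-1, 1] × [-1, 1]` at the crossing of the chord `h`, with `i` the
  position along the circle of the family `plus` and `j` the position along the circle of `minus`;
* `patch s x i t`: a square in the annulus of a circle `x` without chords, with `i` the position
  along the circle and `t` the position across the annulus;
* `ribbon s e t`: the ribbon along the edge `e`, an open interval times `[-1, 1]`, from the end of
  one square to the start of the next; for a circle without chords it joins the two ends of the
  patch;
* `hub c`, `stem z`, `face c`: a sphere with holes of color `c`. From an interior vertex `hub c` an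
  edge `stem z` goes to each boundary circle `z` of color `c`, and these edges cut the sphere with
  holes into one open disc `face c`. -/
inductive SCell where
  | coupon (h : Fin G.n) (p : Fin 5 × Fin 5)
  | patch (s : PM) (x : G.Bubble s) (p : Fin 5 × Fin 5)
  | ribbon (s : PM) (e : G.Edge s) (t : Fin 5)
  | hub (c : Fin G.m)
  | stem (z : G.Cycle)
  | face (c : Fin G.m)

/-- The coordinate along the other strand of the point at position `t` across the strand of the
family `s` through the chord `h`. At a positive crossing the strand of `minus` crosses that of `plus`
from right to left, and the strand of `plus` crosses that of `minus` from left to right. -/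
def across (s : PM) (h : Fin G.n) (t : Fin 5) :
    Fin 5 :=
  match s, G.sign h with
  | .plus, .plus => Fin.rev t
  | .plus, .minus => t
  | .minus, .plus => t
  | .minus, .minus => Fin.rev t

/-- The cell of the square at the start of the edge `e` that has position `a` along and position `t`
across the circle of `e`. -/
def square (s : PM) (e : G.Edge s) (a t : Fin 5) : G.SCell :=
  match s, e with
  | .plus, .inl h => .coupon h (a, G.across .plus h t)
  | .minus, .inl h => .coupon h (G.across .minus h t, a)
  | s, .inr x => .patch s x (a, t)

/-- The extreme position across an annulus on the given side. -/
def border : LR → Fin 5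
  | .left => 0
  | .right => 4

/-- A corner on a boundary circle: the start of one of the sides that the circle consists of. -/
noncomputable def corner (z : G.Cycle) : G.SCell :=
  G.square z.out.1 z.out.2.1 4 (border z.out.2.2)

/-- Whether the boundary arc at position `t` across the annulus of the edge `e` exists and has the
color `c`. -/
def OnBorder (c : Fin G.m) (s : PM) (e : G.Edge s) (t : Fin 5) : Prop :=
  ∃ δ : LR, t = border δ ∧ G.sideColor ⟨s, e, δ⟩ = c

/-- The dimension of a cell of the surface. -/
def sDim : G.SCell → ℕ
  | .coupon _ p => segDim p.1 + segDim p.2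
  | .patch _ _ p => segDim p.1 + segDim p.2
  | .ribbon _ _ t => 1 + segDim t
  | .hub _ => 0
  | .stem _ => 1
  | .face _ => 2

open Classical in
/-- The incidences of the cells of the surface. -/
noncomputable def sMult : G.SCell → G.SCell → ℕ
  | .coupon h p, .coupon h' p' =>
      if h = h' then squareMult p p' else 0
  | .patch s x p, .patch s' x' p' =>
      if (⟨s, x⟩ : Σ s, G.Bubble s) = ⟨s', x'⟩ then
        squareMult p p' else 0
  | .ribbon s e t, .ribbon s' e' t' =>
      if (⟨s, e⟩ : Σ s, G.Edge s) = ⟨s', e'⟩ then segMult t t' else 0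
  | .ribbon s e t, b =>
      (if b = G.square s e 4 t then 1 else 0) +
        (if b = G.square s (G.nextEdge s e) 0 t then 1 else 0)
  | .face c, .ribbon s e t => if G.OnBorder c s e t then 1 else 0
  | .face c, .patch s x (i, t) =>
      if segDim i = 1 ∧ G.OnBorder c s (.inr x) t then 1 else 0
  | .face c, .stem z => if G.color z = c then 2 else 0
  | .stem z, .hub c => if G.color z = c then 1 else 0
  | .stem z, b => if b = G.corner z then 1 else 0
  | _, _ => 0

theorem sDim_square (s : PM) (e : G.Edge s) (a t : Fin 5) :
    G.sDim (G.square s e a t) =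
      segDim a + segDim t := by
  have hr : ∀ t : Fin 5, (Fin.rev t).val % 2 = t.val % 2 := by decide
  have ha : ∀ s h t, segDim (G.across s h t) =
      segDim t := by
    intro s h t
    unfold across
    split
    · exact hr t
    · rfl
    · rfl
    · exact hr t
  rcases s with _ | _ <;> rcases e with h | x
  · simp [square, sDim, ha]
  · simp [square, sDim]
  · simp [square, sDim, ha, add_comm]
  · simp [square, sDim]

theorem dim_border (δ : LR) : segDim (border δ) = 0 := by
  cases δ <;> rfl

open Classical in
theorem sMult_codim_one (a b : G.SCell) (h : G.sMult a b ≠ 0) : G.sDim a = G.sDim b + 1 := by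
  have h4 : segDim (4 : Fin 5) = 0 := rfl
  have h0 : segDim (0 : Fin 5) = 0 := rfl
  have hr : ∀ (s : PM) (e : G.Edge s) (t) (b : G.SCell),
      (if b = G.square s e 4 t then 1 else 0) +
        (if b = G.square s (G.nextEdge s e) 0 t then 1 else 0) ≠ 0 →
      1 + segDim t = G.sDim b + 1 := by
    intro s e t b hb
    have : b = G.square s e 4 t ∨ b = G.square s (G.nextEdge s e) 0 t := by
      by_contra hn
      push Not at hn
      simp [hn.1, hn.2] at hb
    rcases this with rfl | rfl
    · rw [sDim_square, h4]; omega
    · rw [sDim_square, h0]; omega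
  have hs : ∀ (z : G.Cycle) (b : G.SCell), (if b = G.corner z then 1 else 0) ≠ 0 →
      1 = G.sDim b + 1 := by
    intro z b hb
    split_ifs at hb with h1
    · rw [h1, corner, sDim_square, dim_border, h4]
    · exact absurd rfl hb
  have hB : ∀ c s e t, G.OnBorder c s e t → segDim t = 0 := by
    rintro c s e t ⟨δ, rfl, -⟩
    exact dim_border δ
  cases a <;> cases b <;> first
    | exact absurd rfl h
    | exact hr _ _ _ _ h
    | exact hs _ _ h
    | (simp only [sMult] at h
       split_ifs at h with h1
       all_goals first
         | exact absurd rfl h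
         | exact squareMult_codim_one _ _ h
         | rfl
         | (have h2 := segMult_codim_one _ _ h; simp only [sDim]; omega)
         | (have h2 := hB _ _ _ _ h1; simp only [sDim]; omega)
         | (have h2 := hB _ _ _ _ h1.2; simp only [sDim]; omega))

instance : Finite G.Cycle := Quot.finite _

instance : Finite G.SCell := by
  let E := (Fin G.n × Fin 5 × Fin 5) ⊕
    ((Σ s, G.Bubble s) × Fin 5 × Fin 5) ⊕
    ((Σ s, G.Edge s) × Fin 5) ⊕ Fin G.m ⊕ G.Cycle ⊕ Fin G.m
  let f : E → G.SCell
    | .inl (h, p) => .coupon h p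
    | .inr (.inl (⟨s, x⟩, p)) => .patch s x p
    | .inr (.inr (.inl (⟨s, e⟩, t))) => .ribbon s e t
    | .inr (.inr (.inr (.inl c))) => .hub c
    | .inr (.inr (.inr (.inr (.inl z)))) => .stem z
    | .inr (.inr (.inr (.inr (.inr c)))) => .face c
  refine Finite.of_surjective f ?_
  rintro (⟨h, p⟩ | ⟨s, x, p⟩ | ⟨s, e, t⟩ | c | z | c)
  · exact ⟨.inl (h, p), rfl⟩
  · exact ⟨.inr (.inl (⟨s, x⟩, p)), rfl⟩
  · exact ⟨.inr (.inr (.inl (⟨s, e⟩, t))), rfl⟩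
  · exact ⟨.inr (.inr (.inr (.inl c))), rfl⟩
  · exact ⟨.inr (.inr (.inr (.inr (.inl z)))), rfl⟩
  · exact ⟨.inr (.inr (.inr (.inr (.inr c)))), rfl⟩

/-- The closed surface `S(G)`. -/
noncomputable def surface : CellComplex where
  Cell := G.SCell
  finite := inferInstance
  dim := G.sDim
  mult := G.sMult
  codim_one := G.sMult_codim_one

/-- Whether a cell of the surface lies at position `t` across the annulus of the circle `i` of the
family `s`. -/
def AtPosition (s : PM) (i : Fin (G.g s)) (t : Fin 5) (a : G.SCell) :
    Prop :=
  ∃ e : G.Edge s, G.circleOf s e = i ∧ (a = .ribbon s e t ∨ ∃ p, a = G.square s e p t)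

/-- The union `M^s` of the curves of the family `s` on the surface. -/
def curves (s : PM) : Set G.surface.Cell :=
  {a | ∃ i, G.AtPosition s i 2 a}

/-- The spheres with holes are disjoint from the curves. -/
theorem face_mem_compl_curves (s : PM) (c : Fin G.m) :
    (SCell.face c : G.SCell) ∈ ((G.curves s)ᶜ : Set G.SCell) := by
  rintro ⟨i, e, -, h | ⟨p, h⟩⟩
  · cases h
  · rcases s with _ | _ <;> rcases e with k | x <;> cases h

/-! ## The compression bodies -/

/-- The cells of `S(G) × [-1, 1]` with 2-handles attached along the curves of the family `s`.
* `collar a l`: the product of the cell `a` with `{-1}`, `(-1, 1)` or `{1}` for `l = 0, 1, 2`;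
* `handle i` and `disc i δ`: the handle of the circle `i` is a disc times `[-1, 1]`; it consists of
  an open 3-cell `handle i` and two open discs `disc i δ` besides the annulus around the curve `i` in
  `S(G) × {-1}`, along which it is glued. The boundary of the disc `disc i δ` is the boundary circle
  of this annulus on the side `δ`. -/
inductive HCell (s : PM) where
  | collar (a : G.SCell) (l : Fin 3)
  | disc (i : Fin (G.g s)) (δ : LR)
  | handle (i : Fin (G.g s))

/-- The dimension of a cell of the collar with handles. -/
def hDim (s : PM) : G.HCell s → ℕ
  | .collar a l => G.sDim a + segDim l
  | .disc _ _ => 2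
  | .handle _ => 3

open Classical in
/-- The incidences of the cells of the collar with handles. -/
noncomputable def hMult (s : PM) : G.HCell s → G.HCell s → ℕ
  | .collar a l, .collar b k =>
      (if l = k then G.sMult a b else 0) + (if a = b then segMult l k else 0)
  | .disc i δ, .collar b l =>
      if l = 0 ∧ G.sDim b = 1 ∧ G.AtPosition s i (border δ) b then 1 else 0
  | .handle i, .collar b l =>
      if l = 0 ∧ G.sDim b = 2 ∧ ∃ t, G.AtPosition s i t b then 1 else 0
  | .handle i, .disc j _ => if i = j then 1 else 0
  | _, _ => 0

theorem hMult_codim_one (s : PM) (a b : G.HCell s) (h : G.hMult s a b ≠ 0) :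
    G.hDim s a = G.hDim s b + 1 := by
  have h0 : segDim (0 : Fin 3) = 0 := rfl
  rcases a with ⟨a, l⟩ | ⟨i, δ⟩ | i <;> rcases b with ⟨b, k⟩ | ⟨j, δ'⟩ | j <;>
    simp only [hMult] at h <;> try exact absurd rfl h
  · have : (l = k ∧ G.sMult a b ≠ 0) ∨ (a = b ∧ segMult l k ≠ 0) := by
      by_contra hn
      push Not at hn
      apply h
      split_ifs with h1 h2 h2 <;> simp_all
    rcases this with ⟨rfl, h1⟩ | ⟨rfl, h1⟩
    · have := G.sMult_codim_one _ _ h1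
      simp only [hDim]
      omega
    · have := segMult_codim_one _ _ h1
      simp only [hDim]
      omega
  · split_ifs at h with h1
    · simp only [hDim, h1.1, h1.2.1, h0]
    · exact absurd rfl h
  · split_ifs at h with h1
    · simp only [hDim, h1.1, h1.2.1, h0]
    · exact absurd rfl h
  · rfl

instance (s : PM) : Finite (G.HCell s) := by
  let f : (G.SCell × Fin 3) ⊕ (Fin (G.g s) × LR) ⊕ Fin (G.g s) → G.HCell s
    | .inl (a, l) => .collar a l
    | .inr (.inl (i, δ)) => .disc i δ
    | .inr (.inr i) => .handle i
  refine Finite.of_surjective f ?_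
  rintro (⟨a, l⟩ | ⟨i, δ⟩ | i)
  · exact ⟨.inl (a, l), rfl⟩
  · exact ⟨.inr (.inl (i, δ)), rfl⟩
  · exact ⟨.inr (.inr i), rfl⟩

/-- The surface `S(G)` times `[-1, 1]`, with 2-handles attached to `S(G) × {-1}` along the curves of
the family `s`. -/
noncomputable def collarWithHandles (s : PM) : CellComplex where
  Cell := G.HCell s
  finite := inferInstance
  dim := G.hDim s
  mult := G.hMult s
  codim_one := G.hMult_codim_one s

/-- The boundary of the collar with handles, without `S(G) × {1}`. -/
noncomputable def unfilledInnerBoundary (s : PM) : Set (G.collarWithHandles s).Cell :=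
  (G.collarWithHandles s).boundary \ Set.range fun a : G.SCell => HCell.collar a 2

/-- The compression body `H^s`: all spherical components of the boundary but those of `S(G) × {1}`
are filled with 3-balls. -/
noncomputable def compressionBody (s : PM) : CellComplex :=
  (G.collarWithHandles s).fillSpheres (G.unfilledInnerBoundary s)

/-- The outer boundary `S(G) × {1}` of the compression body. -/
def outerBoundary (s : PM) : Set (G.compressionBody s).Cell :=
  Set.range fun a : G.SCell => Sum.inl (HCell.collar a 2)

/-- The inner boundary of the compression body. -/
def innerBoundary (s : PM) : Set (G.compressionBody s).Cell :=
  (G.compressionBody s).boundary \ G.outerBoundary s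

/-- The sum of the genera of the components of the inner boundary of `H^s`. -/
noncomputable def innerGenus (s : PM) : ℚ :=
  ∑ᶠ K : (G.compressionBody s).Component (G.innerBoundary s),
    (G.compressionBody s).genus ((G.compressionBody s).cellsOf K)

/-- The genus of the surface `S(G)`. -/
noncomputable def surfaceGenus : ℚ := G.surface.genus Set.univ

end DecoratedGaussDiagram

/-! Before balls are glued in, the inner boundary of `H^s` is the result of surgery on `S(G)` along
the curves of the family `s`: the open annuli around them are removed and two discs are put in for
each circle (`mem_unfilledInnerBoundary_iff`). An open annulus has Euler characteristic zero, so the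
new surface has `χ = χ(S(G)) + 2 g^s` (`eulerChar_unfilledInnerBoundary`). Each component has genus
`1 - χ / 2`, so the total genus is the number of components minus half of this `χ`. Filling spheres
discards only summands equal to zero (`finsum_genus_fillSpheres`). With `χ(S(G)) = 2 - 2 g_S` the
formula follows once the number of components is known to be `k^s`.

For the components, let each color stand for its sphere with holes. A ribbon or circle of the other
family can be crossed without meeting the annuli of `s`, so adjacent colors lie in one component
(`joined_face_of_adj`), and every component off the open annuli contains a sphere with holes
(`exists_joined_face`). Conversely, `region` sends each cell to a component of the color graph and
is locally constant off the curves (`Incident.region_eq`). The right turn rule enters here: on a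
fixed side of a circle of `s`, the colors before and after a crossing are the colors on the two
sides of one edge of the other family.

The count is made for the complement of the curves and for the surgered surface. The paths for both
are built once, in the complement `offAnnuli` of the open annuli, and then transported. -/

namespace CellComplex

/-! ### Components and Euler characteristics of cell complexes -/

variable {X Y : CellComplex}

theorem componentOf_eq {A : Set X.Cell} {a b : X.Cell} (ha : a ∈ A) (hb : b ∈ A)
    (h : X.mult a b ≠ 0) : X.componentOf A ⟨a, ha⟩ = X.componentOf A ⟨b, hb⟩ :=
  Quot.sound h

instance (A : Set X.Cell) : Finite (X.Component A) := Quot.finite _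

/-- A map between sets of cells that preserves incidences induces a map of components. -/
def Component.map {A : Set X.Cell} {B : Set Y.Cell} (f : X.Cell → Y.Cell)
    (hf : ∀ a ∈ A, f a ∈ B) (hm : ∀ a b, X.mult a b ≠ 0 → Y.mult (f a) (f b) ≠ 0) :
    X.Component A → Y.Component B :=
  Quot.map (fun a => ⟨f a, hf a a.2⟩) fun a b h => hm a b h

/-- The components of `A` correspond to those of a graph on marked cells of `A`, if there is a
locally constant map from `A` to the components of the graph. -/
theorem exists_equiv_connectedComponent {V : Type*} (Γ : SimpleGraph V) {A : Set X.Cell}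
    (φ : X.Cell → Γ.ConnectedComponent) (p : V → A)
    (hφ : ∀ a ∈ A, ∀ b ∈ A, X.mult a b ≠ 0 → φ a = φ b)
    (hp : ∀ v, φ (p v) = Γ.connectedComponentMk v)
    (hadj : ∀ u v, Γ.Adj u v → X.componentOf A (p u) = X.componentOf A (p v))
    (hreach : ∀ a, ∃ v, X.componentOf A a = X.componentOf A (p v)) :
    ∃ f : Γ.ConnectedComponent ≃ X.Component A,
      ∀ v, f (Γ.connectedComponentMk v) = X.componentOf A (p v) := by
  have hwalk : ∀ u v (w : Γ.Walk u v), X.componentOf A (p u) = X.componentOf A (p v) := by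
    intro u v w
    induction w with
    | nil => rfl
    | cons h _ ih => exact (hadj _ _ h).trans ih
  let f : Γ.ConnectedComponent → X.Component A :=
    SimpleGraph.ConnectedComponent.lift (fun v => X.componentOf A (p v))
      fun u v w _ => hwalk u v w
  let g : X.Component A → Γ.ConnectedComponent :=
    Quot.lift (fun a => φ a) fun a b h => hφ a a.2 b b.2 h
  have hgf : ∀ v, g (X.componentOf A (p v)) = Γ.connectedComponentMk v := hp
  refine ⟨⟨f, g, ?_, ?_⟩, fun v => rfl⟩
  · intro K
    induction K using SimpleGraph.ConnectedComponent.ind with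
    | h v => exact hgf v
  · intro K
    obtain ⟨a, rfl⟩ := Quot.exists_rep K
    obtain ⟨v, hv⟩ := hreach a
    change f (g (X.componentOf A a)) = X.componentOf A a
    rw [hv, hgf]
    rfl

theorem eulerChar_image {f : X.Cell → Y.Cell} (hf : Function.Injective f)
    (hdim : ∀ a, Y.dim (f a) = X.dim a) (B : Set X.Cell) :
    Y.eulerChar (f '' B) = X.eulerChar B := by
  unfold eulerChar
  rw [finsum_mem_image hf.injOn]
  simp only [hdim]

/-- The Euler characteristic is the sum of those of the components. -/
theorem finsum_eulerChar_cellsOf (A : Set X.Cell) :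
    ∑ᶠ K : X.Component A, X.eulerChar (X.cellsOf K) = X.eulerChar A := by
  have hU : A = ⋃ K : X.Component A, X.cellsOf K := by
    ext a
    simp only [Set.mem_iUnion]
    exact ⟨fun h => ⟨_, h, rfl⟩, fun ⟨_, h, _⟩ => h⟩
  unfold eulerChar
  conv_rhs => rw [hU]
  rw [finsum_mem_iUnion]
  · intro K L hKL
    rw [Function.onFun, Set.disjoint_left]
    rintro a ⟨h, rfl⟩ ⟨_, rfl⟩
    exact hKL rfl
  · exact fun _ => Set.toFinite _

/-- A sum over the components of a set that consists of some of the components of another one. -/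
theorem finsum_component_eq {M : Type*} [AddCommMonoid M] {ι : X.Cell → Y.Cell}
    (hι : Function.Injective ι) (hdim : ∀ a, Y.dim (ι a) = X.dim a)
    (hmult : ∀ a b, Y.mult (ι a) (ι b) = X.mult a b)
    {A : Set X.Cell} {B : Set Y.Cell} (P : X.Component A → Prop)
    (hB : ∀ y, y ∈ B ↔ ∃ a, ∃ h : a ∈ A, P (X.componentOf A ⟨a, h⟩) ∧ ι a = y) (F : ℤ → M) :
    ∑ᶠ K : Y.Component B, F (Y.eulerChar (Y.cellsOf K)) =
      ∑ᶠ K ∈ {K | P K}, F (X.eulerChar (X.cellsOf K)) := by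
  classical
  choose g₀ hA hP hg using fun y : B => (hB y).1 y.2
  let j : Y.Component B → X.Component A :=
    Quot.lift (fun b => X.componentOf A ⟨g₀ b, hA b⟩) fun b b' h =>
      componentOf_eq _ _ (by rw [← hmult, hg, hg]; exact h)
  -- A partial inverse of `j`, with value `none` where `P` fails. It serves only to show that `j` is
  -- injective.
  let k : X.Component A → Option (Y.Component B) :=
    Quot.lift (fun a => if h : P (X.componentOf A a) then
        some (Y.componentOf B ⟨ι a, (hB _).2 ⟨a, a.2, h, rfl⟩⟩) else none) fun a a' h => by
      have h1 : X.componentOf A a = X.componentOf A a' := Quot.sound h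
      by_cases hh : P (X.componentOf A a)
      · have hh' := h1 ▸ hh
        rw [dif_pos hh, dif_pos hh']
        exact congrArg some (componentOf_eq _ _ (by rw [hmult]; exact h))
      · have hh' := h1 ▸ hh
        rw [dif_neg hh, dif_neg hh']
  have hjP : ∀ K, P (j K) := by
    intro K
    obtain ⟨b, rfl⟩ := Quot.exists_rep K
    exact hP b
  have hkj : ∀ K, k (j K) = some K := by
    intro K
    obtain ⟨b, rfl⟩ := Quot.exists_rep K
    refine (dif_pos (hP b)).trans (congrArg some ?_)
    simp only [hg]
    rfl
  have hjinj : Function.Injective j := fun K L h => by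
    have := congrArg k h
    rwa [hkj, hkj, Option.some_inj] at this
  have hjι : ∀ a (h : a ∈ A) (h' : ι a ∈ B),
      j (Y.componentOf B ⟨ι a, h'⟩) = X.componentOf A ⟨a, h⟩ := by
    intro a h h'
    change X.componentOf A ⟨g₀ ⟨ι a, h'⟩, _⟩ = _
    congr 2
    exact hι (hg _)
  have hrange : {K | P K} = Set.range j := by
    ext K
    refine ⟨fun h => ?_, ?_⟩
    · obtain ⟨a, rfl⟩ := Quot.exists_rep K
      exact ⟨Y.componentOf B ⟨ι a, (hB _).2 ⟨a, a.2, h, rfl⟩⟩, hjι a a.2 _⟩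
    · rintro ⟨K, rfl⟩
      exact hjP K
  have hcells : ∀ K, Y.cellsOf K = ι '' X.cellsOf (j K) := by
    intro K
    ext y
    constructor
    · rintro ⟨h, rfl⟩
      exact ⟨g₀ ⟨y, h⟩, ⟨hA ⟨y, h⟩, rfl⟩, hg ⟨y, h⟩⟩
    · rintro ⟨a, ⟨h, h1⟩, rfl⟩
      have h' : ι a ∈ B := (hB _).2 ⟨a, h, h1 ▸ hjP K, rfl⟩
      exact ⟨h', hjinj ((hjι a h h').trans h1)⟩
  rw [hrange, finsum_mem_range hjinj]
  simp only [hcells, eulerChar_image hι hdim]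

theorem dim_lt_of_transGen {a b : X.Cell}
    (h : Relation.TransGen (fun c d => X.mult c d ≠ 0) a b) : X.dim b < X.dim a := by
  induction h with
  | single h => have := X.codim_one _ _ h; omega
  | tail _ h ih => have := X.codim_one _ _ h; omega

/-- Incidence lowers the dimension, so a 2-cell is in the closure of no other 2-cell and must itself
be one of the generating faces of the boundary. -/
theorem finsum_mult_eq_one {f : X.Cell} (hf : f ∈ X.boundary) (hd : X.dim f = 2) :
    ∑ᶠ b, X.mult b f = 1 := by
  obtain ⟨f', hd', h1, h⟩ := hf
  rcases Relation.reflTransGen_iff_eq_or_transGen.1 h with rfl | h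
  · exact h1
  · have := dim_lt_of_transGen h
    omega

theorem mem_of_reflTransGen {O : Set X.Cell} (hO : ∀ a b, a ∈ O → X.mult a b ≠ 0 → b ∈ O)
    {a b : X.Cell} (h : Relation.ReflTransGen (fun c d => X.mult c d ≠ 0) a b) (ha : a ∈ O) :
    b ∈ O := by
  induction h with
  | refl => exact ha
  | tail _ h ih => exact hO _ _ ih h

/-- Only the cells between `a` and `b` have to lie in `A`. For a boundary minus a closed set `O`,
the closure of a cell may enter `O`, but a descending chain that ends outside `O` never does. -/
theorem componentOf_eq_of_reflTransGen {A : Set X.Cell} {a b : X.Cell} (ha : a ∈ A)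
    (hA : ∀ c, Relation.ReflTransGen (fun c d => X.mult c d ≠ 0) a c →
      Relation.ReflTransGen (fun c d => X.mult c d ≠ 0) c b → c ∈ A)
    (h : Relation.ReflTransGen (fun c d => X.mult c d ≠ 0) a b) :
    X.componentOf A ⟨a, ha⟩ = X.componentOf A ⟨b, hA b h .refl⟩ := by
  induction h with
  | refl => rfl
  | tail h₁ h₂ ih =>
    exact (ih fun c hc hc' => hA c hc (hc'.tail h₂)).trans (componentOf_eq _ _ h₂)

/-! ### Filling the spherical components of a boundary -/

section Fill

variable {O : Set X.Cell}

theorem fillSpheres_total (A : Set X.Cell) (f : X.Cell) :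
    ∑ᶠ b, (X.fillSpheres A).mult b (Sum.inl f) = ∑ᶠ a, X.mult a f +
      ∑ᶠ K : {K : X.Component A // X.eulerChar (X.cellsOf K) = 2},
        (X.fillSpheres A).mult (Sum.inr K) (Sum.inl f) := by
  classical
  have := Fintype.ofFinite X.Cell
  have := Fintype.ofFinite {K : X.Component A // X.eulerChar (X.cellsOf K) = 2}
  let _ : Fintype (X.fillSpheres A).Cell :=
    inferInstanceAs (Fintype (X.Cell ⊕ {K : X.Component A // X.eulerChar (X.cellsOf K) = 2}))
  rw [finsum_eq_sum_of_fintype, finsum_eq_sum_of_fintype, finsum_eq_sum_of_fintype]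
  exact Fintype.sum_sum_type
    fun b : X.Cell ⊕ {K : X.Component A // X.eulerChar (X.cellsOf K) = 2} =>
      (X.fillSpheres A).mult b (Sum.inl f)

theorem fillSpheres_mult_inr (A : Set X.Cell)
    (K : {K : X.Component A // X.eulerChar (X.cellsOf K) = 2}) (f : X.Cell) :
    (X.fillSpheres A).mult (Sum.inr K) (Sum.inl f) ≠ 0 ↔ f ∈ X.cellsOf K.1 ∧ X.dim f = 2 := by
  simp [fillSpheres]

/-- A ball glued to a spherical component runs once more over its 2-cells, whose total was one
already; other 2-cells gain nothing. -/
theorem fillSpheres_total_eq_one_iff (f : X.Cell) (hd : X.dim f = 2) :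
    ∑ᶠ b, (X.fillSpheres (X.boundary \ O)).mult b (Sum.inl f) = 1 ↔
      ∑ᶠ a, X.mult a f = 1 ∧ ∀ h : f ∈ X.boundary \ O,
        X.eulerChar (X.cellsOf (X.componentOf _ ⟨f, h⟩)) ≠ 2 := by
  rw [fillSpheres_total]
  set Z := ∑ᶠ K : {K : X.Component (X.boundary \ O) // X.eulerChar (X.cellsOf K) = 2},
        (X.fillSpheres (X.boundary \ O)).mult (Sum.inr K) (Sum.inl f) with hZ
  by_cases hS : ∀ h : f ∈ X.boundary \ O,
        X.eulerChar (X.cellsOf (X.componentOf _ ⟨f, h⟩)) ≠ 2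
  · have : Z = 0 := by
      rw [hZ]
      refine finsum_eq_zero_of_forall_eq_zero fun K => ?_
      by_contra hK
      obtain ⟨⟨h, h1⟩, -⟩ := (fillSpheres_mult_inr _ _ _).1 hK
      exact hS h (h1 ▸ K.2)
    simp only [this, add_zero, iff_self_and]
    exact fun _ => hS
  · push Not at hS
    obtain ⟨h, h2⟩ := hS
    have : Z ≠ 0 := by
      have h0 := (fillSpheres_mult_inr _ ⟨_, h2⟩ f).2 ⟨⟨h, rfl⟩, hd⟩
      have := single_le_finsum (f := fun K : {K : X.Component (X.boundary \ O) //
        X.eulerChar (X.cellsOf K) = 2} => (X.fillSpheres (X.boundary \ O)).mult (Sum.inr K)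
          (Sum.inl f)) ⟨_, h2⟩ (Set.toFinite _) fun _ => Nat.zero_le _
      exact fun hZ0 => h0 (Nat.le_zero.1 (this.trans hZ0.le))
    rw [finsum_mult_eq_one h.1 hd]
    constructor
    · omega
    · exact fun h' => absurd h2 (h'.2 h)

/-- What is left of the boundary after the spherical components outside of `O` were filled. -/
theorem mem_fillSpheres_boundary (hO : ∀ a b, a ∈ O → X.mult a b ≠ 0 → b ∈ O)
    (y : (X.fillSpheres (X.boundary \ O)).Cell) :
    y ∈ (X.fillSpheres (X.boundary \ O)).boundary \ (Sum.inl '' O : Set (_ ⊕ _)) ↔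
      ∃ a, ∃ h : a ∈ X.boundary \ O,
        X.eulerChar (X.cellsOf (X.componentOf _ ⟨a, h⟩)) ≠ 2 ∧ Sum.inl a = y := by
  set W := X.fillSpheres (X.boundary \ O) with hW
  have hlift : ∀ a b, Relation.ReflTransGen (fun c d => X.mult c d ≠ 0) a b →
      Relation.ReflTransGen (fun c d => W.mult c d ≠ 0) (Sum.inl a) (Sum.inl b) :=
    fun a b h => h.lift Sum.inl fun _ _ h => h
  -- No cell runs over a new ball, so a descending chain that starts at an old cell stays among the
  -- old cells.
  have hdrop : ∀ a y, Relation.ReflTransGen (fun c d => W.mult c d ≠ 0) (Sum.inl a) y →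
      ∃ b, Sum.inl b = y ∧ Relation.ReflTransGen (fun c d => X.mult c d ≠ 0) a b := by
    intro a y h
    induction h with
    | refl => exact ⟨a, rfl, .refl⟩
    | @tail c d _ h ih =>
      obtain ⟨b, rfl, hb⟩ := ih
      rcases d with d | K
      · exact ⟨d, rfl, hb.tail h⟩
      · exact absurd rfl h
  -- As `O` is closed, a chain from `f` to a cell outside `O` avoids `O`; hence both ends lie in one
  -- component, and being spherical is the same for both.
  have hcomp : ∀ f a, X.dim f = 2 → ∑ᶠ b, X.mult b f = 1 → a ∉ O →
      Relation.ReflTransGen (fun c d => X.mult c d ≠ 0) f a →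
      ∃ (hf : f ∈ X.boundary \ O) (ha : a ∈ X.boundary \ O),
        X.componentOf (X.boundary \ O) ⟨f, hf⟩ = X.componentOf (X.boundary \ O) ⟨a, ha⟩ := by
    intro f a hd h1 ha h
    have hmem : ∀ c, Relation.ReflTransGen (fun c d => X.mult c d ≠ 0) f c →
        Relation.ReflTransGen (fun c d => X.mult c d ≠ 0) c a → c ∈ X.boundary \ O :=
      fun c hc hc' => ⟨⟨f, hd, h1, hc⟩, fun hcO => ha (mem_of_reflTransGen hO hc' hcO)⟩
    exact ⟨hmem f .refl h, hmem a h .refl, componentOf_eq_of_reflTransGen _ hmem h⟩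
  constructor
  · rintro ⟨⟨f | K, hd, h1, h⟩, hy⟩
    · obtain ⟨a, rfl, ha⟩ := hdrop f _ h
      have haO : a ∉ O := fun h => hy ⟨a, h, rfl⟩
      obtain ⟨h1, h2⟩ := (fillSpheres_total_eq_one_iff f hd).1 h1
      obtain ⟨hf, ha', he⟩ := hcomp f a hd h1 haO ha
      exact ⟨a, ha', he ▸ h2 hf, rfl⟩
    · exact absurd (show (3 : ℕ) = 2 from hd) (by decide)
  · rintro ⟨a, ⟨⟨f, hd, h1, h⟩, haO⟩, h2, rfl⟩
    obtain ⟨hf, ha', he⟩ := hcomp f a hd h1 haO h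
    refine ⟨⟨Sum.inl f, hd, (fillSpheres_total_eq_one_iff f hd).2
      ⟨h1, fun _ => he ▸ h2⟩, hlift _ _ h⟩, ?_⟩
    rintro ⟨b, hb, hba⟩
    exact haO (Sum.inl.inj hba ▸ hb)

/-- The total genus of a boundary is not changed by filling its spherical components. -/
theorem finsum_genus_fillSpheres (hO : ∀ a b, a ∈ O → X.mult a b ≠ 0 → b ∈ O)
    {B : Set (X.fillSpheres (X.boundary \ O)).Cell}
    (hB : B = (X.fillSpheres (X.boundary \ O)).boundary \ (Sum.inl '' O : Set (_ ⊕ _))) :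
    ∑ᶠ K : (X.fillSpheres (X.boundary \ O)).Component B,
      (X.fillSpheres (X.boundary \ O)).genus ((X.fillSpheres (X.boundary \ O)).cellsOf K) =
    (Nat.card (X.Component (X.boundary \ O)) : ℚ) - (X.eulerChar (X.boundary \ O) : ℚ) / 2 := by
  have := Fintype.ofFinite (X.Component (X.boundary \ O))
  rw [show (∑ᶠ K : (X.fillSpheres (X.boundary \ O)).Component B,
      (X.fillSpheres (X.boundary \ O)).genus ((X.fillSpheres (X.boundary \ O)).cellsOf K)) = _ from
    finsum_component_eq (X := X) (Y := X.fillSpheres (X.boundary \ O)) (ι := Sum.inl)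
    Sum.inl_injective (fun _ => rfl) (fun _ _ => rfl)
    (fun K : X.Component (X.boundary \ O) => X.eulerChar (X.cellsOf K) ≠ 2)
    (fun y => by rw [hB]; exact mem_fillSpheres_boundary hO y) (fun n : ℤ => (1 - (n : ℚ) / 2))]
  rw [← finsum_eulerChar_cellsOf, finsum_eq_sum_of_fintype (f := fun K => X.eulerChar _),
    Nat.card_eq_fintype_card, Int.cast_sum, Finset.sum_div, ← Finset.card_univ, Finset.cast_card, ← Finset.sum_sub_distrib,
    ← finsum_eq_sum_of_fintype]
  refine finsum_congr fun K => ?_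
  -- The components that disappear have `χ = 2` and would contribute `1 - χ / 2 = 0`.
  by_cases h : X.eulerChar (X.cellsOf K) = 2
  · simp [h]
  · simp [h]

end Fill

end CellComplex

/-! ### Positions of cells across the annuli of one family -/

namespace DecoratedGaussDiagram

variable {G : DecoratedGaussDiagram}

theorem across_across (s : PM) (h : Fin G.n) (t : Fin 5) : G.across s h (G.across s h t) = t := by
  unfold across
  split <;> simp

theorem across_eq_zero_or_four (s : PM) (h : Fin G.n) {t : Fin 5} (ht : t = 0 ∨ t = 4) :
    G.across s h t = 0 ∨ G.across s h t = 4 := by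
  unfold across
  rcases ht with rfl | rfl <;> split <;> decide

theorem segMult_across (s : PM) (h : Fin G.n) (t t' : Fin 5) :
    segMult (G.across s h t) (G.across s h t') = segMult t t' := by
  have : ∀ t t' : Fin 5, segMult (Fin.rev t) (Fin.rev t') = segMult t t' := by decide
  unfold across
  split <;> simp [this]

theorem segDim_across (s : PM) (h : Fin G.n) (t : Fin 5) :
    segDim (G.across s h t) = segDim t := by
  have : ∀ t : Fin 5, segDim (Fin.rev t) = segDim t := by decide
  unfold across
  split <;> simp [this]

theorem segMult_self {n : ℕ} (i : Fin n) : segMult i i = 0 := by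
  unfold segMult
  rw [if_neg (by omega)]

theorem squareMult_along (a a' t : Fin 5) : squareMult (a, t) (a', t) = segMult a a' := by
  simp [squareMult, segMult_self]

theorem squareMult_across (a t t' : Fin 5) : squareMult (a, t) (a, t') = segMult t t' := by
  simp [squareMult, segMult_self]

theorem squareMult_ne_zero {p q : Fin 5 × Fin 5} (h : squareMult p q ≠ 0) :
    (p.2 = q.2 ∧ segMult p.1 q.1 ≠ 0) ∨ (p.1 = q.1 ∧ segMult p.2 q.2 ≠ 0) := by
  by_contra hn
  push Not at hn
  apply h
  unfold squareMult
  split_ifs with h1 h2 h2 <;> simp_all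

theorem eq_of_segMult {T : Type*} (f : Fin 5 → T) (hf : ∀ i j, segMult i j ≠ 0 → f i = f j)
    (i j : Fin 5) : f i = f j := by
  have h10 := hf 1 0 (by decide)
  have h12 := hf 1 2 (by decide)
  have h32 := hf 3 2 (by decide)
  have h34 := hf 3 4 (by decide)
  have : ∀ i, f i = f 0 := by
    intro i
    fin_cases i
    · rfl
    · exact h10
    · exact h12.symm.trans h10
    · exact h32.trans (h12.symm.trans h10)
    · exact h34.symm.trans (h32.trans (h12.symm.trans h10))
  rw [this i, this j]

/-- The edge whose annulus contains a cell, with the position of the cell across this annulus. -/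
def coord : (s : PM) → G.SCell → Option (G.Edge s × Fin 5)
  | .plus, .coupon h p => some (.inl h, G.across .plus h p.2)
  | .minus, .coupon h p => some (.inl h, G.across .minus h p.1)
  | .plus, .patch .plus x p => some (.inr x, p.2)
  | .minus, .patch .minus x p => some (.inr x, p.2)
  | .plus, .ribbon .plus e t => some (e, t)
  | .minus, .ribbon .minus e t => some (e, t)
  | _, _ => none

theorem coord_square (s : PM) (e : G.Edge s) (a t : Fin 5) :
    coord s (G.square s e a t) = some (e, t) := by
  rcases s with _ | _ <;> rcases e with h | x <;> simp [square, coord, across_across]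

theorem coord_ribbon (s : PM) (e : G.Edge s) (t : Fin 5) :
    coord s (SCell.ribbon s e t) = some (e, t) := by
  cases s <;> rfl

theorem coord_ribbon_opp (s : PM) (e : G.Edge s.opp) (t : Fin 5) :
    coord s (SCell.ribbon s.opp e t) = none := by
  cases s <;> rfl

theorem coord_patch (s : PM) (x : G.Bubble s) (p : Fin 5 × Fin 5) :
    coord s (SCell.patch s x p) = some (.inr x, p.2) := by
  cases s <;> rfl

theorem coord_patch_opp (s : PM) (x : G.Bubble s.opp) (p : Fin 5 × Fin 5) :
    coord s (SCell.patch s.opp x p) = none := by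
  cases s <;> rfl

/-- A coupon lies in annuli of both families: the position along the other strand is, up to the
reversal in `across`, the position across the strand of `s`. -/
theorem coord_square_opp_inl (s : PM) (h : Fin G.n) (a t : Fin 5) :
    coord s (G.square s.opp (.inl h) a t) = some (.inl h, G.across s h a) := by
  cases s <;> rfl

theorem coord_square_opp_inr (s : PM) (x : G.Bubble s.opp) (a t : Fin 5) :
    coord s (G.square s.opp (.inr x) a t) = none := by
  cases s <;> rfl

theorem coord_hub (s : PM) (c : Fin G.m) : coord s (SCell.hub c : G.SCell) = none := by
  cases s <;> rfl

theorem coord_face (s : PM) (c : Fin G.m) : coord s (SCell.face c : G.SCell) = none := by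
  cases s <;> rfl

theorem coord_stem (s : PM) (z : G.Cycle) : coord s (SCell.stem z : G.SCell) = none := by
  cases s <;> rfl

theorem eq_of_coord {s : PM} {a : G.SCell} {e : G.Edge s} {t : Fin 5}
    (h : coord s a = some (e, t)) : a = .ribbon s e t ∨ ∃ p, a = G.square s e p t := by
  rcases a with ⟨k, p⟩ | ⟨s', x, p⟩ | ⟨s', e', t'⟩ | c | z | c
  · cases s
    · simp only [coord, Option.some_inj, Prod.mk.injEq] at h
      obtain ⟨rfl, rfl⟩ := h
      exact .inr ⟨p.1, by simp [square, across_across]⟩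
    · simp only [coord, Option.some_inj, Prod.mk.injEq] at h
      obtain ⟨rfl, rfl⟩ := h
      exact .inr ⟨p.2, by simp [square, across_across]⟩
  · cases s <;> cases s' <;>
      simp only [coord, Option.some_inj, Prod.mk.injEq, reduceCtorEq] at h
    all_goals
      obtain ⟨rfl, rfl⟩ := h
      exact .inr ⟨p.1, rfl⟩
  · cases s <;> cases s' <;>
      simp only [coord, Option.some_inj, Prod.mk.injEq, reduceCtorEq] at h
    all_goals
      obtain ⟨rfl, rfl⟩ := h
      exact .inl rfl
  · rw [coord_hub] at h; cases h
  · rw [coord_stem] at h; cases h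
  · rw [coord_face] at h; cases h

theorem atPosition_iff {s : PM} {i : Fin (G.g s)} {t : Fin 5} {a : G.SCell} :
    G.AtPosition s i t a ↔ ∃ e, G.circleOf s e = i ∧ coord s a = some (e, t) := by
  constructor
  · rintro ⟨e, he, rfl | ⟨p, rfl⟩⟩
    · exact ⟨e, he, coord_ribbon s e t⟩
    · exact ⟨e, he, coord_square s e p t⟩
  · rintro ⟨e, he, h⟩
    exact ⟨e, he, eq_of_coord h⟩

theorem mem_curves_iff {s : PM} {a : G.SCell} :
    a ∈ (G.curves s : Set G.SCell) ↔ ∃ e, coord s a = some (e, 2) := by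
  constructor
  · rintro ⟨i, h⟩
    obtain ⟨e, -, h⟩ := atPosition_iff.1 h
    exact ⟨e, h⟩
  · rintro ⟨e, h⟩
    exact ⟨_, atPosition_iff.2 ⟨e, rfl, h⟩⟩

/-! ### The geometric kinds of incidence on the surface -/

/-- The incidences of the cells of the surface without their multiplicities. -/
inductive Incident : G.SCell → G.SCell → Prop
  | coupon (h) (p q) : squareMult p q ≠ 0 → Incident (.coupon h p) (.coupon h q)
  | patch (s x) (p q) : squareMult p q ≠ 0 → Incident (.patch s x p) (.patch s x q)
  | ribbon (s e) (t t') : segMult t t' ≠ 0 → Incident (.ribbon s e t) (.ribbon s e t')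
  | ribbon_end (s e t) : Incident (.ribbon s e t) (G.square s e 4 t)
  | ribbon_start (s e t) : Incident (.ribbon s e t) (G.square s (G.nextEdge s e) 0 t)
  | face_ribbon (s e δ) : Incident (.face (G.sideColor ⟨s, e, δ⟩)) (.ribbon s e (border δ))
  | face_patch (s x i δ) : segDim i = 1 →
      Incident (.face (G.sideColor ⟨s, .inr x, δ⟩)) (.patch s x (i, border δ))
  | face_stem (z) : Incident (.face (G.color z)) (.stem z)
  | stem_hub (z) : Incident (.stem z) (.hub (G.color z))
  | stem_corner (z) : Incident (.stem z) (G.corner z)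

/-- The clauses of `sMult` for a ribbon or a stem over a square reduce only once the square is known
to be a coupon or a patch. -/
theorem square_cases {motive : G.SCell → Prop} (s : PM) (e : G.Edge s) (a t : Fin 5)
    (coupon : ∀ h p, motive (.coupon h p)) (patch : ∀ x p, motive (.patch s x p)) :
    motive (G.square s e a t) := by
  rcases s with _ | _ <;> rcases e with h | x <;> simp [square, coupon, patch]

open Classical in
theorem sMult_ribbon_square (s : PM) (e : G.Edge s) (t : Fin 5) (s' : PM) (e' : G.Edge s')
    (a t' : Fin 5) :
    G.sMult (.ribbon s e t) (G.square s' e' a t') =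
      (if G.square s' e' a t' = G.square s e 4 t then 1 else 0) +
        (if G.square s' e' a t' = G.square s (G.nextEdge s e) 0 t then 1 else 0) := by
  refine square_cases (motive := fun b => G.sMult (.ribbon s e t) b =
      (if b = G.square s e 4 t then 1 else 0) +
        (if b = G.square s (G.nextEdge s e) 0 t then 1 else 0)) s' e' a t' ?_ ?_ <;>
    intros <;> rfl

open Classical in
theorem sMult_stem_square (z : G.Cycle) (s' : PM) (e' : G.Edge s') (a t' : Fin 5) :
    G.sMult (.stem z) (G.square s' e' a t') =
      if G.square s' e' a t' = G.corner z then 1 else 0 := by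
  refine square_cases (motive := fun b => G.sMult (.stem z) b =
      if b = G.corner z then 1 else 0) s' e' a t' ?_ ?_ <;>
    intros <;> rfl

theorem Incident.sMult_ne_zero {a b : G.SCell} (h : Incident a b) : G.sMult a b ≠ 0 := by
  classical
  cases h with
  | coupon h p q hm => simpa [sMult] using hm
  | patch s x p q hm => simpa [sMult] using hm
  | ribbon s e t t' hm => simpa [sMult] using hm
  | ribbon_end s e t => simp [sMult_ribbon_square]
  | ribbon_start s e t => simp [sMult_ribbon_square]
  | face_ribbon s e δ =>
    have : G.OnBorder (G.sideColor ⟨s, e, δ⟩) s e (border δ) := ⟨δ, rfl, rfl⟩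
    simp [sMult, this]
  | face_patch s x i δ hi =>
    have : G.OnBorder (G.sideColor ⟨s, .inr x, δ⟩) s (.inr x) (border δ) := ⟨δ, rfl, rfl⟩
    simp [sMult, this, hi]
  | face_stem z => simp [sMult]
  | stem_hub z => simp [sMult]
  | stem_corner z => simp [corner, sMult_stem_square]

/-- Together with `Incident.sMult_ne_zero` this replaces the 36 pairs of kinds of cells in `sMult`
by ten geometric cases. -/
theorem incident_of_sMult_ne_zero {a b : G.SCell} (h : G.sMult a b ≠ 0) : Incident a b := by
  classical
  have hr : ∀ (s : PM) (e : G.Edge s) (t) (b : G.SCell),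
      (if b = G.square s e 4 t then 1 else 0) +
        (if b = G.square s (G.nextEdge s e) 0 t then 1 else 0) ≠ 0 →
      Incident (.ribbon s e t) b := by
    intro s e t b hb
    by_cases h1 : b = G.square s e 4 t
    · rw [h1]; exact .ribbon_end s e t
    · by_cases h2 : b = G.square s (G.nextEdge s e) 0 t
      · rw [h2]; exact .ribbon_start s e t
      · simp [h1, h2] at hb
  have hs : ∀ (z : G.Cycle) (b : G.SCell), (if b = G.corner z then 1 else 0) ≠ 0 →
      Incident (.stem z) b := by
    intro z b hb
    split_ifs at hb with h1
    · rw [h1]; exact .stem_corner z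
    · exact absurd rfl hb
  cases a <;> cases b <;> first
    | exact absurd rfl h
    | exact hr _ _ _ _ h
    | exact hs _ _ h
    | skip
  · simp only [sMult] at h
    split_ifs at h with h1
    · subst h1; exact .coupon _ _ _ h
    · exact absurd rfl h
  · simp only [sMult] at h
    split_ifs at h with h1
    · cases h1; exact .patch _ _ _ _ h
    · exact absurd rfl h
  · simp only [sMult] at h
    split_ifs at h with h1
    · cases h1; exact .ribbon _ _ _ _ h
    · exact absurd rfl h
  · simp only [sMult] at h
    split_ifs at h with h1
    · subst h1; exact .stem_hub _
    · exact absurd rfl h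
  · simp only [sMult] at h
    split_ifs at h with h1
    · obtain ⟨h1, δ, h2, rfl⟩ := h1
      rename_i p
      obtain ⟨i, t⟩ := p
      obtain rfl : t = border δ := h2
      exact .face_patch _ _ _ _ h1
    · exact absurd rfl h
  · simp only [sMult] at h
    split_ifs at h with h1
    · obtain ⟨δ, rfl, rfl⟩ := h1
      exact .face_ribbon _ _ _
    · exact absurd rfl h
  · simp only [sMult] at h
    split_ifs at h with h1
    · subst h1; exact .face_stem _
    · exact absurd rfl h

end DecoratedGaussDiagram

/-! ### Colors around a crossing and the regions of the color graph -/

theorem PM.eq_or_eq_opp (s s' : PM) : s' = s ∨ s' = s.opp := by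
  cases s <;> cases s' <;> simp [PM.opp]

/-- The side of an annulus on which a position across it lies. -/
def sideAt (t : Fin 5) : LR := if t.val < 2 then .left else .right

namespace DecoratedGaussDiagram

theorem sideAt_border (δ : LR) : sideAt (border δ) = δ := by
  cases δ <;> rfl

/-- The side changes only by passing the core position `2`. -/
theorem sideAt_eq_of_segMult : ∀ t t' : Fin 5, segMult t t' ≠ 0 → t ≠ 2 → t' ≠ 2 →
    sideAt t = sideAt t' := by
  decide

theorem exists_eq_border {t : Fin 5} (ht : t = 0 ∨ t = 4) : ∃ δ, t = border δ := by
  rcases ht with rfl | rfl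
  · exact ⟨.left, rfl⟩
  · exact ⟨.right, rfl⟩

theorem border_eq (δ : LR) : border δ = 0 ∨ border δ = 4 := by
  cases δ
  · exact .inl rfl
  · exact .inr rfl

variable {G : DecoratedGaussDiagram}

theorem sideColor_eq_of_turn {x y : G.Side} (h : G.Turn x y) : G.sideColor x = G.sideColor y :=
  congrArg G.color (Quot.sound h)

/-- At a crossing, one side of the outgoing edge of `s` meets the outgoing edge of the other
family. -/
theorem exists_sideColor_outgoing (s : PM) (h : Fin G.n) :
    ∃ δ, G.sideColor ⟨s, .inl h, sideAt (G.across s h 4)⟩ =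
      G.sideColor (⟨s.opp, G.outgoing s.opp h, δ⟩ : G.Side) := by
  cases s <;> cases hs : G.sign h <;> simp only [across, hs]
  · exact ⟨.right, sideColor_eq_of_turn (.pos_b₂ h hs)⟩
  · exact ⟨.left, sideColor_eq_of_turn (.neg_b₁ h hs)⟩
  · exact ⟨.left, (sideColor_eq_of_turn (.pos_b₂ h hs)).symm⟩
  · exact ⟨.right, (sideColor_eq_of_turn (.neg_b₁ h hs)).symm⟩

/-- At a crossing, one side of the outgoing edge of `s` meets the incoming edge of the other
family. -/
theorem exists_sideColor_incoming (s : PM) (h : Fin G.n) :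
    ∃ δ, G.sideColor ⟨s, .inl h, sideAt (G.across s h 0)⟩ =
      G.sideColor (⟨s.opp, G.incoming s.opp h, δ⟩ : G.Side) := by
  cases s <;> cases hs : G.sign h <;> simp only [across, hs]
  · exact ⟨.right, sideColor_eq_of_turn (.pos_b₁ h hs)⟩
  · exact ⟨.left, sideColor_eq_of_turn (.neg_b₂ h hs)⟩
  · exact ⟨.left, (sideColor_eq_of_turn (.pos_a₂ h hs)).symm⟩
  · exact ⟨.right, (sideColor_eq_of_turn (.neg_a₁ h hs)).symm⟩

/-- On each side of a strand, the incoming and the outgoing edge at a crossing meet the two sides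
of one edge of the other family. -/
theorem exists_sideColor_crossing (s : PM) (h : Fin G.n) (δ : LR) :
    ∃ e : G.Edge s.opp, ∃ δ₁ δ₂, G.sideColor ⟨s, G.incoming s h, δ⟩ = G.sideColor ⟨s.opp, e, δ₁⟩ ∧
      G.sideColor ⟨s, .inl h, δ⟩ = G.sideColor ⟨s.opp, e, δ₂⟩ := by
  cases s <;> cases hs : G.sign h <;> cases δ
  · exact ⟨_, _, _, sideColor_eq_of_turn (.pos_a₂ h hs), sideColor_eq_of_turn (.pos_b₂ h hs)⟩
  · exact ⟨_, _, _, sideColor_eq_of_turn (.pos_a₁ h hs), sideColor_eq_of_turn (.pos_b₁ h hs)⟩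
  · exact ⟨_, _, _, sideColor_eq_of_turn (.neg_a₂ h hs), sideColor_eq_of_turn (.neg_b₂ h hs)⟩
  · exact ⟨_, _, _, sideColor_eq_of_turn (.neg_a₁ h hs), sideColor_eq_of_turn (.neg_b₁ h hs)⟩
  · exact ⟨_, _, _, (sideColor_eq_of_turn (.pos_a₁ h hs)).symm,
      (sideColor_eq_of_turn (.pos_a₂ h hs)).symm⟩
  · exact ⟨_, _, _, (sideColor_eq_of_turn (.pos_b₁ h hs)).symm,
      (sideColor_eq_of_turn (.pos_b₂ h hs)).symm⟩
  · exact ⟨_, _, _, (sideColor_eq_of_turn (.neg_b₂ h hs)).symm,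
      (sideColor_eq_of_turn (.neg_b₁ h hs)).symm⟩
  · exact ⟨_, _, _, (sideColor_eq_of_turn (.neg_a₂ h hs)).symm,
      (sideColor_eq_of_turn (.neg_a₁ h hs)).symm⟩

/-- The component of the color graph that belongs to a side of an edge. -/
def sideRegion (s : PM) (x : G.Side) : (G.colorGraph s).ConnectedComponent :=
  (G.colorGraph s).connectedComponentMk (G.sideColor x)

/-- The two colors of an edge of the other family are equal or adjacent, by the definition of the
color graph. -/
theorem sideRegion_opp (s : PM) (e : G.Edge s.opp) (δ δ' : LR) :
    sideRegion s (⟨s.opp, e, δ⟩ : G.Side) = sideRegion s ⟨s.opp, e, δ'⟩ := by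
  have key : sideRegion s (G.fst e) = sideRegion s (G.snd e) := by
    by_cases h : G.sideColor (G.fst e) = G.sideColor (G.snd e)
    · exact congrArg (G.colorGraph s).connectedComponentMk h
    · refine SimpleGraph.ConnectedComponent.sound (SimpleGraph.Adj.reachable ?_)
      exact (SimpleGraph.fromRel_adj _ _ _).2 ⟨h, .inl ⟨e, rfl, rfl⟩⟩
  cases δ <;> cases δ'
  · rfl
  · exact key.symm
  · exact key
  · rfl

/-- Passing a crossing on one side of the strand means crossing an edge of the other family, whose
two colors lie in one component of the color graph. -/
theorem sideRegion_incoming (s : PM) (h : Fin G.n) (δ : LR) :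
    sideRegion s (⟨s, G.incoming s h, δ⟩ : G.Side) = sideRegion s ⟨s, .inl h, δ⟩ := by
  obtain ⟨e, δ₁, δ₂, h₁, h₂⟩ := exists_sideColor_crossing s h δ
  have := sideRegion_opp s e δ₁ δ₂
  unfold sideRegion at this ⊢
  rw [h₁, h₂, this]

theorem sideRegion_nextEdge (s : PM) (e : G.Edge s) (δ : LR) :
    sideRegion s (⟨s, G.nextEdge s e, δ⟩ : G.Side) = sideRegion s ⟨s, e, δ⟩ := by
  rcases e with h | x
  · have := sideRegion_incoming s (G.next s h) δ
    rw [GaussDiagram.incoming, Equiv.symm_apply_apply] at this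
    exact this.symm
  · rfl

/-- The strand of the other family leaves the square of `h` at its position `4`, which is the
position `across s h 4` across the strand of `s`. -/
theorem sideRegion_outgoing (s : PM) (h : Fin G.n) (δ : LR) :
    sideRegion s (⟨s, .inl h, sideAt (G.across s h 4)⟩ : G.Side) =
      sideRegion s ⟨s.opp, .inl h, δ⟩ := by
  obtain ⟨δ', h'⟩ := exists_sideColor_outgoing s h
  rw [sideRegion_opp s (.inl h) δ δ']
  exact congrArg (G.colorGraph s).connectedComponentMk h'

/-- This is the far end of the same edge: it enters the square of the next chord at position `0`
along its strand. -/
theorem sideRegion_next (s : PM) (h : Fin G.n) (δ : LR) :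
    sideRegion s (⟨s, .inl (G.next s.opp h), sideAt (G.across s (G.next s.opp h) 0)⟩ : G.Side) =
      sideRegion s ⟨s.opp, .inl h, δ⟩ := by
  obtain ⟨δ', h'⟩ := exists_sideColor_incoming s (G.next s.opp h)
  rw [GaussDiagram.incoming, Equiv.symm_apply_apply] at h'
  rw [sideRegion_opp s (.inl h) δ δ']
  exact congrArg (G.colorGraph s).connectedComponentMk h'

/-- The component of the color graph that belongs to a cell of the surface off the curves. -/
def region (s : PM) (a : G.SCell) : (G.colorGraph s).ConnectedComponent :=
  match coord s a with
  | some (e, t) => sideRegion s ⟨s, e, sideAt t⟩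
  -- Only ribbons and patches of the other family and the cells of the spheres with holes get here;
  -- the coupon clause is never reached. The choice of `.left` is immaterial by `sideRegion_opp`.
  | none => match a with
    | .coupon h _ => sideRegion s ⟨s, .inl h, .left⟩
    | .patch s' x _ => sideRegion s ⟨s', .inr x, .left⟩
    | .ribbon s' e _ => sideRegion s ⟨s', e, .left⟩
    | .hub c => (G.colorGraph s).connectedComponentMk c
    | .stem z => (G.colorGraph s).connectedComponentMk (G.color z)
    | .face c => (G.colorGraph s).connectedComponentMk c

theorem region_of_coord {s : PM} {a : G.SCell} {e : G.Edge s} {t : Fin 5}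
    (h : coord s a = some (e, t)) : region s a = sideRegion s ⟨s, e, sideAt t⟩ := by
  simp only [region, h]

theorem region_ribbon_opp (s : PM) (e : G.Edge s.opp) (t : Fin 5) :
    region s (SCell.ribbon s.opp e t) = sideRegion s ⟨s.opp, e, .left⟩ := by
  simp only [region, coord_ribbon_opp]

theorem region_patch_opp (s : PM) (x : G.Bubble s.opp) (p : Fin 5 × Fin 5) :
    region s (SCell.patch s.opp x p) = sideRegion s ⟨s.opp, .inr x, .left⟩ := by
  simp only [region, coord_patch_opp]

theorem region_face (s : PM) (c : Fin G.m) :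
    region s (SCell.face c : G.SCell) = (G.colorGraph s).connectedComponentMk c := by
  simp only [region, coord_face]

theorem region_hub (s : PM) (c : Fin G.m) :
    region s (SCell.hub c : G.SCell) = (G.colorGraph s).connectedComponentMk c := by
  simp only [region, coord_hub]

theorem region_stem (s : PM) (z : G.Cycle) :
    region s (SCell.stem z : G.SCell) = (G.colorGraph s).connectedComponentMk (G.color z) := by
  simp only [region, coord_stem]

theorem square_inr (s : PM) (x : G.Bubble s) (a t : Fin 5) :
    G.square s (.inr x) a t = .patch s x (a, t) := by
  cases s <;> rfl

theorem exists_coord_coupon (s : PM) (h : Fin G.n) {p q : Fin 5 × Fin 5}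
    (hm : squareMult p q ≠ 0) : ∃ t t', coord s (SCell.coupon h p : G.SCell) = some (.inl h, t) ∧
      coord s (SCell.coupon h q : G.SCell) = some (.inl h, t') ∧ (t = t' ∨ segMult t t' ≠ 0) := by
  cases s
  · refine ⟨_, _, rfl, rfl, ?_⟩
    rw [segMult_across]
    rcases squareMult_ne_zero hm with h | h
    · exact .inl (by rw [h.1])
    · exact .inr h.2
  · refine ⟨_, _, rfl, rfl, ?_⟩
    rw [segMult_across]
    rcases squareMult_ne_zero hm with h | h
    · exact .inr h.2
    · exact .inl (by rw [h.1])

/-- An incidence off the curves stays on one side of an annulus of `s`, continues along its circle,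
passes from it into a ribbon of the other family, stays off the annuli of `s`, or meets a sphere
with holes whose color is that of the adjacent side. -/
theorem Incident.region_eq {s : PM} {a b : G.SCell} (h : Incident a b)
    (ha : ∀ e, coord s a ≠ some (e, 2)) (hb : ∀ e, coord s b ≠ some (e, 2)) :
    region s a = region s b := by
  have key : ∀ {a b : G.SCell} {e : G.Edge s} {t t' : Fin 5},
      (∀ e, coord s a ≠ some (e, 2)) → (∀ e, coord s b ≠ some (e, 2)) →
      coord s a = some (e, t) → coord s b = some (e, t') → (t = t' ∨ segMult t t' ≠ 0) →
      region s a = region s b := by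
    intro a b e t t' ha hb h1 h2 h3
    rw [region_of_coord h1, region_of_coord h2]
    rcases h3 with rfl | h3
    · rfl
    · rw [sideAt_eq_of_segMult t t' h3]
      · rintro rfl; exact ha _ h1
      · rintro rfl; exact hb _ h2
  have hopp : ∀ (e : G.Edge s.opp) (t : Fin 5) (δ : LR),
      region s (G.square s.opp e 4 t) = sideRegion s ⟨s.opp, e, δ⟩ := by
    rintro (h | x) t δ
    · rw [region_of_coord (coord_square_opp_inl s h 4 t), sideRegion_outgoing s h δ]
    · rw [square_inr, region_patch_opp, sideRegion_opp]
  cases h with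
  | coupon h p q hm =>
    obtain ⟨t, t', h1, h2, h3⟩ := exists_coord_coupon s h hm
    exact key ha hb h1 h2 h3
  | patch s' x p q hm =>
    rcases PM.eq_or_eq_opp s s' with rfl | rfl
    · refine key ha hb (coord_patch _ _ _) (coord_patch _ _ _) ?_
      rcases squareMult_ne_zero hm with h | h
      · exact .inl h.1
      · exact .inr h.2
    · rw [region_patch_opp, region_patch_opp]
  | ribbon s' e t t' hm =>
    rcases PM.eq_or_eq_opp s s' with rfl | rfl
    · exact key ha hb (coord_ribbon _ _ _) (coord_ribbon _ _ _) (.inr hm)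
    · rw [region_ribbon_opp, region_ribbon_opp]
  | ribbon_end s' e t =>
    rcases PM.eq_or_eq_opp s s' with rfl | rfl
    · exact key ha hb (coord_ribbon _ _ _) (coord_square _ _ _ _) (.inl rfl)
    · rw [region_ribbon_opp, hopp e t .left]
  | ribbon_start s' e t =>
    rcases PM.eq_or_eq_opp s s' with rfl | rfl
    · rw [region_of_coord (coord_ribbon _ _ _), region_of_coord (coord_square _ _ _ _),
        sideRegion_nextEdge]
    · rw [region_ribbon_opp]
      rcases e with h | x
      · rw [GaussDiagram.nextEdge, region_of_coord (coord_square_opp_inl s _ 0 t),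
          sideRegion_next s h .left]
      · rw [GaussDiagram.nextEdge, square_inr, region_patch_opp]
  | face_ribbon s' e δ =>
    rw [region_face]
    rcases PM.eq_or_eq_opp s s' with rfl | rfl
    · rw [region_of_coord (coord_ribbon _ _ _), sideAt_border]
      rfl
    · rw [region_ribbon_opp, sideRegion_opp s e .left δ]
      rfl
  | face_patch s' x i δ hi =>
    rw [region_face]
    rcases PM.eq_or_eq_opp s s' with rfl | rfl
    · rw [region_of_coord (coord_patch _ _ _), sideAt_border]
      rfl
    · rw [region_patch_opp, sideRegion_opp s _ .left δ]
      rfl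
  | face_stem z => rw [region_face, region_stem]
  | stem_hub z => rw [region_hub, region_stem]
  | stem_corner z =>
    -- The representative side can be arbitrary: only its color, which is that of `z`, matters.
    have hz : G.color z = G.sideColor z.out := congrArg G.color (Quot.out_eq z).symm
    rw [region_stem, hz, corner]
    obtain ⟨s', e, δ⟩ := z.out
    rcases PM.eq_or_eq_opp s s' with rfl | rfl
    · rw [region_of_coord (coord_square _ _ _ _), sideAt_border]
      rfl
    · exact (hopp e _ δ).symm

/-! ### Paths off the open annuli, and the components of the complement of the curves -/

/-- The complement of the open annuli around the curves of the family `s`. -/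
def offAnnuli (s : PM) : Set G.surface.Cell :=
  {a | ∀ e t, coord s a = some (e, t) → t = 0 ∨ t = 4}

theorem mem_offAnnuli_of_coord {s : PM} {a : G.SCell} {e : G.Edge s} {t : Fin 5}
    (h : coord s a = some (e, t)) (ht : t = 0 ∨ t = 4) : a ∈ (offAnnuli s : Set G.SCell) := by
  intro e' t' h'
  rw [h, Option.some_inj, Prod.mk.injEq] at h'
  exact h'.2 ▸ ht

theorem mem_offAnnuli_of_coord_eq_none {s : PM} {a : G.SCell} (h : coord s a = none) :
    a ∈ (offAnnuli s : Set G.SCell) := by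
  intro e' t' h'
  rw [h] at h'
  cases h'

theorem exists_coord_of_notMem {s : PM} {a : G.SCell}
    (h : a ∉ (offAnnuli s : Set G.SCell)) : ∃ e t, coord s a = some (e, t) ∧ ¬ (t = 0 ∨ t = 4) := by
  by_contra hn
  exact h fun e t he => by_contra fun ht => hn ⟨e, t, he, ht⟩

theorem face_mem_offAnnuli (s : PM) (c : Fin G.m) :
    (SCell.face c : G.SCell) ∈ (offAnnuli s : Set G.SCell) :=
  mem_offAnnuli_of_coord_eq_none (coord_face s c)

/-- Two cells off the open annuli lie in the same component. -/
def Joined (s : PM) (a b : G.SCell) : Prop :=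
  ∃ (ha : a ∈ (offAnnuli s : Set G.SCell)) (hb : b ∈ (offAnnuli s : Set G.SCell)),
    G.surface.componentOf (offAnnuli s) ⟨a, ha⟩ = G.surface.componentOf (offAnnuli s) ⟨b, hb⟩

theorem Joined.symm {s : PM} {a b : G.SCell} : Joined s a b → Joined s b a :=
  fun ⟨ha, hb, h⟩ => ⟨hb, ha, h.symm⟩

theorem Joined.trans {s : PM} {a b c : G.SCell} : Joined s a b → Joined s b c → Joined s a c :=
  fun ⟨ha, _, h⟩ ⟨_, hc, h'⟩ => ⟨ha, hc, h.trans h'⟩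

theorem Incident.joined {s : PM} {a b : G.SCell} (h : Incident a b)
    (ha : a ∈ (offAnnuli s : Set G.SCell)) (hb : b ∈ (offAnnuli s : Set G.SCell)) :
    Joined s a b :=
  ⟨ha, hb, Quot.sound h.sMult_ne_zero⟩

theorem incident_square_along (s : PM) (e : G.Edge s) {a a' : Fin 5} (t : Fin 5)
    (h : segMult a a' ≠ 0) : Incident (G.square s e a t) (G.square s e a' t) := by
  rcases s with _ | _ <;> rcases e with k | x
  · exact .coupon _ _ _ (by rwa [squareMult_along])
  · exact .patch _ _ _ _ (by rwa [squareMult_along])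
  · exact .coupon _ _ _ (by rwa [squareMult_across])
  · exact .patch _ _ _ _ (by rwa [squareMult_along])

theorem incident_square_across (s : PM) (e : G.Edge s) (a : Fin 5) {t t' : Fin 5}
    (h : segMult t t' ≠ 0) : Incident (G.square s e a t) (G.square s e a t') := by
  rcases s with _ | _ <;> rcases e with k | x
  · exact .coupon _ _ _ (by rwa [squareMult_across, segMult_across])
  · exact .patch _ _ _ _ (by rwa [squareMult_across])
  · exact .coupon _ _ _ (by rwa [squareMult_along, segMult_across])
  · exact .patch _ _ _ _ (by rwa [squareMult_across])

theorem joined_of_segMult {s : PM} (f : Fin 5 → G.SCell)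
    (hf : ∀ i, f i ∈ (offAnnuli s : Set G.SCell))
    (hi : ∀ i j, segMult i j ≠ 0 → Incident (f i) (f j)) (i j : Fin 5) :
    Joined s (f i) (f j) :=
  ⟨hf i, hf j, eq_of_segMult (fun i => G.surface.componentOf (offAnnuli s) ⟨f i, hf i⟩)
    (fun i j h => Quot.sound (hi i j h).sMult_ne_zero) i j⟩

theorem joined_ribbon_opp (s : PM) (e : G.Edge s.opp) (t t' : Fin 5) :
    Joined s (SCell.ribbon s.opp e t) (SCell.ribbon s.opp e t') :=
  joined_of_segMult (fun t => SCell.ribbon s.opp e t)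
    (fun t => mem_offAnnuli_of_coord_eq_none (coord_ribbon_opp s e t))
    (fun i j h => .ribbon s.opp e i j h) t t'

/-- A ribbon of the other family misses the annuli of `s` altogether, so it can be crossed from
either side. -/
theorem joined_face_ribbon_opp (s : PM) (e : G.Edge s.opp) (δ : LR) (t : Fin 5) :
    Joined s (SCell.face (G.sideColor ⟨s.opp, e, δ⟩)) (SCell.ribbon s.opp e t) :=
  ((Incident.face_ribbon s.opp e δ).joined (face_mem_offAnnuli s _)
    (mem_offAnnuli_of_coord_eq_none (coord_ribbon_opp s e _))).trans (joined_ribbon_opp s e _ t)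

theorem joined_face_ribbon (s : PM) (e : G.Edge s) (δ : LR) :
    Joined s (SCell.face (G.sideColor ⟨s, e, δ⟩)) (SCell.ribbon s e (border δ)) :=
  (Incident.face_ribbon s e δ).joined (face_mem_offAnnuli s _)
    (mem_offAnnuli_of_coord (coord_ribbon s e _) (border_eq δ))

/-- The path follows the border of the ribbon to its start, at position `4` of the square, and then
the border of the square. -/
theorem joined_face_square (s : PM) (e : G.Edge s) (a : Fin 5) (δ : LR) :
    Joined s (SCell.face (G.sideColor ⟨s, e, δ⟩)) (G.square s e a (border δ)) := by
  have hm : ∀ a, G.square s e a (border δ) ∈ (offAnnuli s : Set G.SCell) := fun a =>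
    mem_offAnnuli_of_coord (coord_square s e a _) (border_eq δ)
  have h1 := joined_face_ribbon s e δ
  exact (h1.trans ((Incident.ribbon_end s e _).joined h1.choose_spec.choose (hm 4))).trans
    (joined_of_segMult _ hm (fun i j h => incident_square_along s e _ h) 4 a)

theorem coupon_eq_square (s : PM) (h : Fin G.n) (p : Fin 5 × Fin 5) :
    ∃ a t, (SCell.coupon h p : G.SCell) = G.square s (.inl h) a t := by
  cases s
  · exact ⟨p.1, G.across .plus h p.2, by simp [square, across_across]⟩
  · exact ⟨p.2, G.across .minus h p.1, by simp [square, across_across]⟩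

/-- Each component off the open annuli contains a sphere with holes. -/
theorem exists_joined_face (s : PM) (a : G.SCell) (ha : a ∈ (offAnnuli s : Set G.SCell)) :
    ∃ c, Joined s (SCell.face c) a := by
  have hsq : ∀ (e : G.Edge s) (i t : Fin 5), G.square s e i t ∈ (offAnnuli s : Set G.SCell) →
      ∃ c, Joined s (SCell.face c) (G.square s e i t) := by
    intro e i t h
    obtain ⟨δ, rfl⟩ := exists_eq_border (h _ _ (coord_square s e i t))
    exact ⟨_, joined_face_square s e i δ⟩
  have hstem : ∀ z : G.Cycle, Joined s (SCell.face (G.color z)) (.stem z) := fun z =>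
    (Incident.face_stem z).joined (face_mem_offAnnuli s _)
      (mem_offAnnuli_of_coord_eq_none (coord_stem s z))
  rcases a with ⟨h, p⟩ | ⟨s', x, p⟩ | ⟨s', e, t⟩ | c | z | c
  · obtain ⟨i, t, h'⟩ := coupon_eq_square s h p
    rw [h'] at ha ⊢
    exact hsq _ _ _ ha
  · rcases PM.eq_or_eq_opp s s' with rfl | rfl
    · rw [← square_inr] at ha ⊢
      exact hsq _ _ _ ha
    · have hm : ∀ p, SCell.patch s.opp x p ∈ (offAnnuli s : Set G.SCell) := fun p =>
        mem_offAnnuli_of_coord_eq_none (coord_patch_opp s x p)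
      have h1 := joined_face_ribbon_opp s (.inr x) .left p.2
      have h2 := Incident.ribbon_end s.opp (.inr x : G.Edge s.opp) p.2
      rw [square_inr] at h2
      exact ⟨_, (h1.trans (h2.joined h1.choose_spec.choose (hm _))).trans
        (joined_of_segMult (fun i => SCell.patch s.opp x (i, p.2)) (fun i => hm _)
          (fun i j h => .patch _ _ _ _ (by rwa [squareMult_along])) 4 p.1)⟩
  · rcases PM.eq_or_eq_opp s s' with rfl | rfl
    · obtain ⟨δ, rfl⟩ := exists_eq_border (ha _ _ (coord_ribbon s' e t))
      exact ⟨_, joined_face_ribbon s' e δ⟩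
    · exact ⟨_, joined_face_ribbon_opp s e .left t⟩
  -- A hub is reached only over a stem, which exists because every color is used.
  · obtain ⟨z, rfl⟩ := G.color_surjective c
    exact ⟨_, (hstem z).trans ((Incident.stem_hub z).joined
      (mem_offAnnuli_of_coord_eq_none (coord_stem s z))
      (mem_offAnnuli_of_coord_eq_none (coord_hub s _)))⟩
  · exact ⟨_, hstem z⟩
  · exact ⟨c, face_mem_offAnnuli s c, face_mem_offAnnuli s c, rfl⟩

theorem joined_face_of_adj (s : PM) (p q : Fin G.m) (h : (G.colorGraph s).Adj p q) :
    Joined s (SCell.face p : G.SCell) (SCell.face q) := by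
  have key : ∀ e : G.Edge s.opp, Joined s (SCell.face (G.sideColor (G.fst e)) : G.SCell)
      (SCell.face (G.sideColor (G.snd e))) := fun e =>
    (joined_face_ribbon_opp s e .right 0).trans (joined_face_ribbon_opp s e .left 0).symm
  obtain ⟨-, ⟨e, rfl, rfl⟩ | ⟨e, rfl, rfl⟩⟩ := (SimpleGraph.fromRel_adj _ _ _).1 h
  · exact key e
  · exact (key e).symm

/-- The same paths serve for the inclusion into the complement of the curves and for the copy in
`S(G) × {-1}`. -/
theorem Joined.map {s : PM} {a b : G.SCell} (h : Joined s a b) {Y : CellComplex} {B : Set Y.Cell}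
    (f : G.SCell → Y.Cell) (hf : ∀ a ∈ (offAnnuli s : Set G.SCell), f a ∈ B)
    (hm : ∀ a b, G.sMult a b ≠ 0 → Y.mult (f a) (f b) ≠ 0) :
    ∃ (ha : f a ∈ B) (hb : f b ∈ B), Y.componentOf B ⟨f a, ha⟩ = Y.componentOf B ⟨f b, hb⟩ := by
  obtain ⟨ha, hb, h⟩ := h
  exact ⟨hf a ha, hf b hb, congrArg
    (CellComplex.Component.map (X := G.surface) (A := offAnnuli s) f hf hm) h⟩

theorem exists_equiv_component_compl_curves (s : PM) :
    ∃ f : (G.colorGraph s).ConnectedComponent ≃ G.surface.Component (G.curves s)ᶜ,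
      ∀ c : Fin G.m, f ((G.colorGraph s).connectedComponentMk c) =
        G.surface.componentOf (G.curves s)ᶜ ⟨.face c, G.face_mem_compl_curves s c⟩ := by
  have hsub : ∀ a ∈ (offAnnuli s : Set G.SCell), a ∈ ((G.curves s)ᶜ : Set G.SCell) := by
    intro a ha h
    obtain ⟨e, he⟩ := mem_curves_iff.1 h
    rcases ha _ _ he with h | h <;> exact absurd h (by decide)
  have hne : ∀ {a : G.SCell}, a ∈ ((G.curves s)ᶜ : Set G.SCell) → ∀ e, coord s a ≠ some (e, 2) :=
    fun h e he => h (mem_curves_iff.2 ⟨e, he⟩)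
  refine CellComplex.exists_equiv_connectedComponent (X := G.surface) (G.colorGraph s) (region s)
    (fun c => ⟨.face c, G.face_mem_compl_curves s c⟩) ?_ (region_face s) ?_ ?_
  · intro a ha b hb h
    exact (incident_of_sMult_ne_zero h).region_eq (hne ha) (hne hb)
  · intro p q h
    obtain ⟨_, _, h⟩ := (joined_face_of_adj s p q h).map (Y := G.surface) id hsub fun _ _ h => h
    exact h
  · have key : ∀ (a : G.SCell) (h : a ∈ (offAnnuli s : Set G.SCell)), ∃ c,
        G.surface.componentOf (G.curves s)ᶜ ⟨a, hsub a h⟩ =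
          G.surface.componentOf (G.curves s)ᶜ ⟨.face c, G.face_mem_compl_curves s c⟩ := by
      intro a ha
      obtain ⟨c, hc⟩ := exists_joined_face s a ha
      obtain ⟨_, _, h⟩ := hc.map (Y := G.surface) id hsub fun _ _ h => h
      exact ⟨c, h.symm⟩
    rintro ⟨a, ha⟩
    by_cases hoff : a ∈ (offAnnuli s : Set G.SCell)
    · exact key a hoff
    · have : ∃ b ∈ (offAnnuli s : Set G.SCell), Incident a b := by
        obtain ⟨e, t, he, ht⟩ := exists_coord_of_notMem hoff
        have ht2 : t ≠ 2 := by
          rintro rfl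
          exact hne ha _ he
        -- The positions `1` and `3` are what the complement of the curves has in addition; one step
        -- leads from them to a border.
        have hseg : ∀ t : Fin 5, ¬ (t = 0 ∨ t = 4) → t ≠ 2 →
            ∃ t', (t' = 0 ∨ t' = 4) ∧ segMult t t' ≠ 0 := by decide
        obtain ⟨t', ht', hm⟩ := hseg t ht ht2
        rcases eq_of_coord he with rfl | ⟨p, rfl⟩
        · exact ⟨_, mem_offAnnuli_of_coord (coord_ribbon s e t') ht', .ribbon _ _ _ _ hm⟩
        · exact ⟨_, mem_offAnnuli_of_coord (coord_square s e p t') ht',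
            incident_square_across s e p hm⟩
      obtain ⟨b, hb, hab⟩ := this
      obtain ⟨c, hc⟩ := key b hb
      exact ⟨c, (CellComplex.componentOf_eq (X := G.surface) ha (hsub b hb)
        hab.sMult_ne_zero).trans hc⟩

end DecoratedGaussDiagram

/-! ### Total incidence different from one -/

namespace CellComplex

variable {X : CellComplex}

theorem total_ne_one_of_two_le {a b : X.Cell} (h : 2 ≤ X.mult b a) :
    ∑ᶠ b, X.mult b a ≠ 1 := by
  have := single_le_finsum (f := fun b => X.mult b a) b (Set.toFinite _) fun _ => Nat.zero_le _
  omega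

theorem total_ne_one_of_ne {a b b' : X.Cell} (hne : b ≠ b') (h : X.mult b a ≠ 0)
    (h' : X.mult b' a ≠ 0) : ∑ᶠ b, X.mult b a ≠ 1 := by
  classical
  have := Fintype.ofFinite X.Cell
  rw [finsum_eq_sum_of_fintype]
  have := Finset.sum_le_sum_of_subset (f := fun b => X.mult b a)
    (Finset.subset_univ ({b, b'} : Finset X.Cell))
  rw [Finset.sum_pair hne] at this
  omega

theorem eulerChar_union {B C : Set X.Cell} (h : Disjoint B C) :
    X.eulerChar (B ∪ C) = X.eulerChar B + X.eulerChar C :=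
  finsum_mem_union h (Set.toFinite _) (Set.toFinite _)

end CellComplex

namespace DecoratedGaussDiagram

variable {G : DecoratedGaussDiagram}

/-! ### The surface is closed -/

theorem square_ne_ribbon (s : PM) (e : G.Edge s) (a t : Fin 5) (s' : PM) (e' : G.Edge s')
    (t' : Fin 5) : G.square s e a t ≠ .ribbon s' e' t' :=
  square_cases (motive := fun b => b ≠ .ribbon s' e' t') s e a t
    (by intro _ _ h; cases h) (by intro _ _ h; cases h)

theorem square_injective (s : PM) {e e' : G.Edge s} {a a' t t' : Fin 5}
    (h : G.square s e a t = G.square s e' a' t') : e = e' ∧ a = a' ∧ t = t' := by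
  have h1 := congrArg (coord s) h
  rw [coord_square, coord_square, Option.some_inj, Prod.mk.injEq] at h1
  obtain ⟨rfl, rfl⟩ := h1
  refine ⟨rfl, ?_, rfl⟩
  rcases s with _ | _ <;> rcases e with h | x <;> simpa [square] using h

theorem exists_nextEdge_eq (s : PM) (e : G.Edge s) : ∃ e', G.nextEdge s e' = e := by
  rcases e with h | x
  · exact ⟨.inl ((G.next s).symm h), by simp [GaussDiagram.nextEdge]⟩
  · exact ⟨.inr x, rfl⟩

/-- An even position has a neighbor before and after it along the strand: both in the square for
`2`, and one in the square and one in a ribbon for `0` and `4`. -/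
theorem exists_cofaces_square (s : PM) (e : G.Edge s) (a t : Fin 5) (ha : segDim a = 0) :
    ∃ b b', b ≠ b' ∧ Incident b (G.square s e a t) ∧ Incident b' (G.square s e a t) := by
  have : a = 0 ∨ a = 2 ∨ a = 4 := by
    revert a; decide
  rcases this with rfl | rfl | rfl
  · obtain ⟨e', rfl⟩ := exists_nextEdge_eq s e
    exact ⟨_, _, square_ne_ribbon _ _ _ _ _ _ _,
      incident_square_along s _ (a := 1) t (by decide), .ribbon_start s e' t⟩
  · refine ⟨_, _, fun h => ?_, incident_square_along s e (a := 1) t (by decide),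
      incident_square_along s e (a := 3) t (by decide)⟩
    exact absurd (square_injective s h).2.1 (by decide)
  · exact ⟨_, _, square_ne_ribbon _ _ _ _ _ _ _,
      incident_square_along s _ (a := 3) t (by decide), .ribbon_end s e t⟩

/-- Two faces, or the two sides of one face, meet along each edge of the surface. -/
theorem exists_cofaces (a : G.SCell) (ha : G.sDim a = 1) :
    (∃ b b', b ≠ b' ∧ Incident b a ∧ Incident b' a) ∨ ∃ b, 2 ≤ G.sMult b a := by
  have hpos : ∀ t : Fin 5, segDim t = 0 → t = 2 ∨ ∃ δ : LR, t = border δ := by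
    intro t ht
    have : t = 0 ∨ t = 2 ∨ t = 4 := by
      revert t; decide
    rcases this with rfl | rfl | rfl
    · exact .inr ⟨.left, rfl⟩
    · exact .inl rfl
    · exact .inr ⟨.right, rfl⟩
  have hseg : ∀ δ, ∃ t : Fin 5, segMult t (border δ) ≠ 0 := by
    rintro (_ | _)
    · exact ⟨1, by decide⟩
    · exact ⟨3, by decide⟩
  rcases a with ⟨h, i, j⟩ | ⟨s, x, i, t⟩ | ⟨s, e, t⟩ | c | z | c
  · simp only [sDim] at ha
    left
    -- Exactly one coordinate is even; the two faces lie before and after the cell along the strand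
    -- with this coordinate.
    by_cases hi : segDim i = 0
    · have := exists_cofaces_square .plus (.inl h : G.Edge .plus) i (G.across .plus h j) hi
      simpa [square, across_across] using this
    · have hj : segDim j = 0 := by omega
      have := exists_cofaces_square .minus (.inl h : G.Edge .minus) j (G.across .minus h i) hj
      simpa [square, across_across] using this
  · simp only [sDim] at ha
    left
    by_cases hi : segDim i = 0
    · have := exists_cofaces_square s (.inr x : G.Edge s) i t hi
      rwa [square_inr] at this
    · have hi1 : segDim i = 1 := by omega
      rcases hpos t (by omega) with rfl | ⟨δ, rfl⟩
      · refine ⟨.patch s x (i, 1), .patch s x (i, 3), by simp, .patch _ _ _ _ ?_,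
          .patch _ _ _ _ ?_⟩ <;> rw [squareMult_across] <;> decide
      · obtain ⟨t, ht⟩ := hseg δ
        refine ⟨.patch s x (i, t), _, ?_, .patch _ _ _ _ ?_, .face_patch _ _ _ _ hi1⟩
        · simp
        · rwa [squareMult_across]
  · simp only [sDim] at ha
    left
    rcases hpos t (by omega) with rfl | ⟨δ, rfl⟩
    · exact ⟨.ribbon s e 1, .ribbon s e 3, by simp, .ribbon _ _ _ _ (by decide),
        .ribbon _ _ _ _ (by decide)⟩
    · obtain ⟨t, ht⟩ := hseg δ
      exact ⟨.ribbon s e t, _, by simp, .ribbon _ _ _ _ ht, .face_ribbon _ _ _⟩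
  · cases ha
  · exact .inr ⟨.face (G.color z), by simp [sMult]⟩
  · cases ha

/-! ### Closures off the annuli -/

theorem square_opp_mem_offAnnuli (s : PM) (e : G.Edge s.opp) {a : Fin 5} (t : Fin 5)
    (ha : a = 0 ∨ a = 4) : G.square s.opp e a t ∈ (offAnnuli s : Set G.SCell) := by
  rcases e with h | x
  · exact mem_offAnnuli_of_coord (coord_square_opp_inl s h a t) (across_eq_zero_or_four s h ha)
  · exact mem_offAnnuli_of_coord_eq_none (coord_square_opp_inr s x a t)

/-- The set `offAnnuli s` is closed: the end positions `0` and `4` of a divided interval have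
nothing below them, and ribbons of the other family end at the borders of the annuli of `s`. -/
theorem Incident.mem_offAnnuli {s : PM} {a b : G.SCell} (h : Incident a b)
    (ha : a ∈ (offAnnuli s : Set G.SCell)) : b ∈ (offAnnuli s : Set G.SCell) := by
  have hseg : ∀ t t' : Fin 5, (t = 0 ∨ t = 4) → segMult t t' = 0 := by decide
  have key : ∀ {a b : G.SCell} {e : G.Edge s} {t t' : Fin 5}, a ∈ (offAnnuli s : Set G.SCell) →
      coord s a = some (e, t) → coord s b = some (e, t') → (t = t' ∨ segMult t t' ≠ 0) →
      b ∈ (offAnnuli s : Set G.SCell) := by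
    intro a b e t t' ha h1 h2 h3
    have ht := ha e t h1
    rcases h3 with rfl | h3
    · exact mem_offAnnuli_of_coord h2 ht
    · exact absurd (hseg t t' ht) h3
  cases h with
  | coupon h p q hm =>
    obtain ⟨t, t', h1, h2, h3⟩ := exists_coord_coupon s h hm
    exact key ha h1 h2 h3
  | patch s' x p q hm =>
    rcases PM.eq_or_eq_opp s s' with rfl | rfl
    · refine key ha (coord_patch _ _ _) (coord_patch _ _ _) ?_
      rcases squareMult_ne_zero hm with h | h
      · exact .inl h.1
      · exact .inr h.2
    · exact mem_offAnnuli_of_coord_eq_none (coord_patch_opp s x q)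
  | ribbon s' e t t' hm =>
    rcases PM.eq_or_eq_opp s s' with rfl | rfl
    · exact key ha (coord_ribbon _ _ _) (coord_ribbon _ _ _) (.inr hm)
    · exact mem_offAnnuli_of_coord_eq_none (coord_ribbon_opp s e t')
  | ribbon_end s' e t =>
    rcases PM.eq_or_eq_opp s s' with rfl | rfl
    · exact key ha (coord_ribbon _ _ _) (coord_square _ _ _ _) (.inl rfl)
    · exact square_opp_mem_offAnnuli s e t (.inr rfl)
  | ribbon_start s' e t =>
    rcases PM.eq_or_eq_opp s s' with rfl | rfl
    · exact mem_offAnnuli_of_coord (coord_square _ _ _ _) (ha _ _ (coord_ribbon _ _ _))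
    · exact square_opp_mem_offAnnuli s _ t (.inl rfl)
  | face_ribbon s' e δ =>
    rcases PM.eq_or_eq_opp s s' with rfl | rfl
    · exact mem_offAnnuli_of_coord (coord_ribbon _ _ _) (border_eq δ)
    · exact mem_offAnnuli_of_coord_eq_none (coord_ribbon_opp s e _)
  | face_patch s' x i δ hi =>
    rcases PM.eq_or_eq_opp s s' with rfl | rfl
    · exact mem_offAnnuli_of_coord (coord_patch _ _ _) (border_eq δ)
    · exact mem_offAnnuli_of_coord_eq_none (coord_patch_opp s x _)
  | face_stem z => exact mem_offAnnuli_of_coord_eq_none (coord_stem s z)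
  | stem_hub z => exact mem_offAnnuli_of_coord_eq_none (coord_hub s _)
  | stem_corner z =>
    rw [corner]
    obtain ⟨s', e, δ⟩ := z.out
    rcases PM.eq_or_eq_opp s s' with rfl | rfl
    · exact mem_offAnnuli_of_coord (coord_square _ _ _ _) (border_eq δ)
    · exact square_opp_mem_offAnnuli s e _ (.inr rfl)

theorem exists_odd (i : Fin 5) : ∃ i' : Fin 5, segDim i' = 1 ∧ (i' = i ∨ segMult i' i ≠ 0) := by
  revert i
  decide

theorem square_inl_eq_square_opp (s : PM) (h : Fin G.n) (i t : Fin 5) :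
    G.square s (.inl h) i t = G.square s.opp (.inl h) (G.across s h t) (G.across s.opp h i) := by
  cases s
  · change SCell.coupon h _ = SCell.coupon h _
    rw [show PM.plus.opp = PM.minus from rfl, across_across]
  · change SCell.coupon h _ = SCell.coupon h _
    rw [show PM.minus.opp = PM.plus from rfl, across_across]

/-- Each cell off the open annuli lies in the closure of a face off the open annuli. -/
theorem exists_face_reflTransGen (s : PM) (a : G.SCell) (ha : a ∈ (offAnnuli s : Set G.SCell)) :
    ∃ f ∈ (offAnnuli s : Set G.SCell), G.sDim f = 2 ∧ Relation.ReflTransGen Incident f a := by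
  have hribbon : ∀ (e : G.Edge s.opp) t, segDim t = 1 →
      SCell.ribbon s.opp e t ∈ (offAnnuli s : Set G.SCell) ∧
        G.sDim (SCell.ribbon s.opp e t) = 2 := fun e t ht =>
    ⟨mem_offAnnuli_of_coord_eq_none (coord_ribbon_opp s e t), by simp only [sDim, ht]⟩
  -- At an odd position the border of a square is an edge. At a crossing a ribbon of the other
  -- family ends there; in a patch it lies on a sphere with holes.
  have hodd : ∀ (e : G.Edge s) (i : Fin 5) (δ : LR), segDim i = 1 →
      ∃ f ∈ (offAnnuli s : Set G.SCell), G.sDim f = 2 ∧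
        Incident f (G.square s e i (border δ)) := by
    rintro (h | x) i δ hi
    · rw [square_inl_eq_square_opp]
      have hd : segDim (G.across s.opp h i) = 1 := by rw [segDim_across, hi]
      rcases across_eq_zero_or_four s h (border_eq δ) with h0 | h4
      · obtain ⟨e', he'⟩ := exists_nextEdge_eq s.opp (.inl h : G.Edge s.opp)
        refine ⟨_, (hribbon e' _ hd).1, (hribbon e' _ hd).2, ?_⟩
        rw [h0, ← he']
        exact .ribbon_start _ _ _
      · refine ⟨_, (hribbon (.inl h) _ hd).1, (hribbon (.inl h) _ hd).2, ?_⟩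
        rw [h4]
        exact .ribbon_end _ _ _
    · refine ⟨_, face_mem_offAnnuli s (G.sideColor ⟨s, .inr x, δ⟩), rfl, ?_⟩
      rw [square_inr]
      exact .face_patch _ _ _ _ hi
  have hsq : ∀ (e : G.Edge s) (i t : Fin 5), G.square s e i t ∈ (offAnnuli s : Set G.SCell) →
      ∃ f ∈ (offAnnuli s : Set G.SCell), G.sDim f = 2 ∧
        Relation.ReflTransGen Incident f (G.square s e i t) := by
    intro e i t h
    obtain ⟨δ, rfl⟩ := exists_eq_border (h _ _ (coord_square s e i t))
    obtain ⟨i', hi', hii'⟩ := exists_odd i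
    obtain ⟨f, hf, hd, hinc⟩ := hodd e i' δ hi'
    refine ⟨f, hf, hd, ?_⟩
    rcases hii' with rfl | hm
    · exact .single hinc
    · exact (Relation.ReflTransGen.single hinc).tail (incident_square_along s e _ hm)
  rcases a with ⟨h, p⟩ | ⟨s', x, i, t⟩ | ⟨s', e, t⟩ | c | z | c
  · obtain ⟨i, t, h'⟩ := coupon_eq_square s h p
    rw [h'] at ha ⊢
    exact hsq _ _ _ ha
  · rcases PM.eq_or_eq_opp s s' with rfl | rfl
    · rw [← square_inr] at ha ⊢
      exact hsq _ _ _ ha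
    · obtain ⟨i', hi', hii'⟩ := exists_odd i
      obtain ⟨t', ht', htt'⟩ := exists_odd t
      refine ⟨.patch s.opp x (i', t'), mem_offAnnuli_of_coord_eq_none (coord_patch_opp s x _),
        by simp only [sDim, hi', ht'], ?_⟩
      have h1 : Relation.ReflTransGen Incident (SCell.patch s.opp x (i', t') : G.SCell)
          (.patch s.opp x (i', t)) := by
        rcases htt' with rfl | hm
        · exact .refl
        · exact .single (.patch _ _ _ _ (by rwa [squareMult_across]))
      rcases hii' with rfl | hm
      · exact h1
      · exact h1.tail (.patch _ _ _ _ (by rwa [squareMult_along]))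
  · rcases PM.eq_or_eq_opp s s' with rfl | rfl
    · obtain ⟨δ, rfl⟩ := exists_eq_border (ha _ _ (coord_ribbon s' e t))
      exact ⟨_, face_mem_offAnnuli s' _, rfl, .single (.face_ribbon s' e δ)⟩
    · obtain ⟨t', ht', htt'⟩ := exists_odd t
      refine ⟨_, (hribbon e _ ht').1, (hribbon e _ ht').2, ?_⟩
      rcases htt' with rfl | hm
      · exact .refl
      · exact .single (.ribbon _ _ _ _ hm)
  · obtain ⟨z, rfl⟩ := G.color_surjective c
    exact ⟨_, face_mem_offAnnuli s _, rfl,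
      (Relation.ReflTransGen.single (.face_stem z)).tail (.stem_hub z)⟩
  · exact ⟨_, face_mem_offAnnuli s _, rfl, .single (.face_stem z)⟩
  · exact ⟨_, face_mem_offAnnuli s c, rfl, .refl⟩

/-! ### The boundary of the collar with handles -/

theorem sDim_le_two (a : G.SCell) : G.sDim a ≤ 2 := by
  have : ∀ t : Fin 5, segDim t ≤ 1 := by decide
  rcases a with ⟨h, i, j⟩ | ⟨s, x, i, t⟩ | ⟨s, e, t⟩ | c | z | c <;> simp only [sDim]
  · have h1 := this i; have h2 := this j; omega
  · have h1 := this i; have h2 := this t; omega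
  · have := this t; omega
  all_goals omega

theorem sDim_le_one_of_coord {s : PM} {a : G.SCell} {e : G.Edge s} {t : Fin 5}
    (h : coord s a = some (e, t)) (ht : t = 0 ∨ t = 4) : G.sDim a ≤ 1 := by
  have h0 : segDim t = 0 := by rcases ht with rfl | rfl <;> rfl
  have : ∀ t : Fin 5, segDim t ≤ 1 := by decide
  rcases eq_of_coord h with rfl | ⟨p, rfl⟩
  · simp only [sDim, h0]; omega
  · rw [sDim_square, h0]; exact this p

theorem hMult_collar_same (s : PM) (a b : G.SCell) (l : Fin 3) :
    G.hMult s (.collar a l) (.collar b l) = G.sMult a b := by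
  have : segMult l l = 0 := segMult_self l
  simp [hMult, this]

theorem hMult_collar_ne_zero {s : PM} {a b : G.SCell} {l k : Fin 3}
    (h : G.hMult s (.collar a l) (.collar b k) ≠ 0) :
    (l = k ∧ Incident a b) ∨ (a = b ∧ segMult l k ≠ 0) := by
  by_contra hn
  push Not at hn
  apply h
  have h1 : l = k → G.sMult a b = 0 := fun hl => by
    by_contra hm
    exact hn.1 hl (incident_of_sMult_ne_zero hm)
  simp only [hMult]
  split_ifs with h2 h3 h3
  · rw [h1 h2, hn.2 h3]
  · rw [h1 h2]
  · rw [hn.2 h3]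
  · rfl

theorem hMult_disc_ne_zero {s : PM} {i : Fin (G.g s)} {δ : LR} {b : G.SCell} {l : Fin 3}
    (h : G.hMult s (.disc i δ) (.collar b l) ≠ 0) :
    l = 0 ∧ G.sDim b = 1 ∧ ∃ e, G.circleOf s e = i ∧ coord s b = some (e, border δ) := by
  simp only [hMult] at h
  split_ifs at h with h1
  · exact ⟨h1.1, h1.2.1, atPosition_iff.1 h1.2.2⟩
  · exact absurd rfl h

/-- The collar runs once over each face of `S(G) × {-1}`, and a handle runs in addition over the
faces in its annulus. -/
theorem collar_total_eq_one_iff (s : PM) (a : G.SCell) (ha : G.sDim a = 2) :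
    ∑ᶠ b, G.hMult s b (.collar a 0) = 1 ↔ a ∈ (offAnnuli s : Set G.SCell) := by
  have hcollar : G.hMult s (.collar a 1) (.collar a 0) = 1 := by
    simp [hMult, segMult]
  constructor
  · intro h1
    by_contra hoff
    obtain ⟨e, t, he, -⟩ := exists_coord_of_notMem hoff
    refine CellComplex.total_ne_one_of_ne (X := G.collarWithHandles s) (a := .collar a 0)
      (b := .collar a 1) (b' := .handle (G.circleOf s e)) ?_ ?_ ?_ h1
    · intro h; cases h
    · exact hcollar.trans_ne one_ne_zero
    · change G.hMult s (.handle (G.circleOf s e)) (.collar a 0) ≠ 0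
      simp only [hMult]
      rw [if_pos ⟨rfl, ha, t, atPosition_iff.2 ⟨e, rfl, he⟩⟩]
      exact one_ne_zero
  · intro hoff
    rw [finsum_eq_single _ (.collar a 1), hcollar]
    rintro (⟨b, l⟩ | ⟨i, δ⟩ | i) hb
    · by_contra h
      rcases hMult_collar_ne_zero h with ⟨rfl, h'⟩ | ⟨rfl, h'⟩
      · have := G.sMult_codim_one _ _ h'.sMult_ne_zero
        have := sDim_le_two b
        omega
      · refine hb ?_
        have : ∀ l : Fin 3, segMult l 0 ≠ 0 → l = 1 := by decide
        rw [this l h']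
    · by_contra h
      have := (hMult_disc_ne_zero h).2.1
      omega
    · simp only [hMult, ite_eq_right_iff]
      rintro ⟨-, -, t, ht⟩
      obtain ⟨e, -, he⟩ := atPosition_iff.1 ht
      have := sDim_le_one_of_coord he (hoff e t he)
      omega

theorem disc_total (s : PM) (i : Fin (G.g s)) (δ : LR) :
    ∑ᶠ b, G.hMult s b (.disc i δ) = 1 := by
  rw [finsum_eq_single _ (.handle i)]
  · simp [hMult]
  · rintro (⟨b, l⟩ | ⟨j, δ'⟩ | j) hb
    · rfl
    · rfl
    · have : j ≠ i := by rintro rfl; exact hb rfl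
      simp [hMult, this]

/-- Vertical 2-cells of the collar are interior because the surface is closed. -/
theorem collar_middle_total (s : PM) (a : G.SCell) (ha : G.sDim a = 1) :
    ∑ᶠ b, G.hMult s b (.collar a 1) ≠ 1 := by
  rcases exists_cofaces a ha with ⟨b, b', hne, h, h'⟩ | ⟨b, h⟩
  · refine CellComplex.total_ne_one_of_ne (X := G.collarWithHandles s) (a := .collar a 1)
      (b := .collar b 1) (b' := .collar b' 1) ?_ ?_ ?_
    · intro h; cases h; exact hne rfl
    · exact (hMult_collar_same s b a 1).trans_ne h.sMult_ne_zero
    · exact (hMult_collar_same s b' a 1).trans_ne h'.sMult_ne_zero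
  · exact CellComplex.total_ne_one_of_two_le (X := G.collarWithHandles s) (a := .collar a 1)
      (b := .collar b 1) (h.trans (hMult_collar_same s b a 1).ge)

theorem outer_closed (s : PM) (x y : G.HCell s)
    (hx : x ∈ Set.range fun a : G.SCell => (HCell.collar a 2 : G.HCell s))
    (h : G.hMult s x y ≠ 0) :
    y ∈ Set.range fun a : G.SCell => (HCell.collar a 2 : G.HCell s) := by
  obtain ⟨a, rfl⟩ := hx
  rcases y with ⟨b, k⟩ | ⟨i, δ⟩ | i
  · rcases hMult_collar_ne_zero h with ⟨rfl, -⟩ | ⟨-, h⟩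
    · exact ⟨b, rfl⟩
    · have : ∀ k : Fin 3, segMult 2 k = 0 := by decide
      exact absurd (this k) h
  · exact absurd rfl h
  · exact absurd rfl h

/-- The boundary after the surgery along the curves. -/
theorem mem_unfilledInnerBoundary_iff {s : PM} {x : G.HCell s} :
    x ∈ (G.unfilledInnerBoundary s : Set (G.HCell s)) ↔
      (∃ a ∈ (offAnnuli s : Set G.SCell), x = .collar a 0) ∨ ∃ i δ, x = .disc i δ := by
  constructor
  · rintro ⟨⟨f, hd, h1, h⟩, hx⟩
    -- The claimed set together with the outer boundary: it contains all faces of total incidence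
    -- one and is closed under passing to boundaries.
    let C : Set (G.HCell s) := {x | ((∃ a ∈ (offAnnuli s : Set G.SCell), x = .collar a 0) ∨
      ∃ i δ, x = .disc i δ) ∨ x ∈ Set.range fun a : G.SCell => (HCell.collar a 2 : G.HCell s)}
    have hf : f ∈ C := by
      rcases f with ⟨a, l⟩ | ⟨i, δ⟩ | i
      · change G.sDim a + segDim l = 2 at hd
        fin_cases l
        · exact .inl (.inl ⟨a, (collar_total_eq_one_iff s a (by simpa [segDim] using hd)).1 h1,
            rfl⟩)
        · exact absurd h1 (collar_middle_total s a (by simpa [segDim] using hd))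
        · exact .inr ⟨a, rfl⟩
      · exact .inl (.inr ⟨i, δ, rfl⟩)
      · cases hd
    have hC : ∀ x y : G.HCell s, x ∈ C → G.hMult s x y ≠ 0 → y ∈ C := by
      rintro x y ((⟨a, ha, rfl⟩ | ⟨i, δ, rfl⟩) | hx) h
      · rcases y with ⟨b, k⟩ | ⟨i, δ⟩ | i
        · rcases hMult_collar_ne_zero h with ⟨rfl, h'⟩ | ⟨-, h'⟩
          · exact .inl (.inl ⟨b, h'.mem_offAnnuli ha, rfl⟩)
          · have : ∀ k : Fin 3, segMult 0 k = 0 := by decide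
            exact absurd (this k) h'
        · exact absurd rfl h
        · exact absurd rfl h
      · rcases y with ⟨b, k⟩ | ⟨i, δ⟩ | i
        · obtain ⟨rfl, -, e, -, he⟩ := hMult_disc_ne_zero h
          exact .inl (.inl ⟨b, mem_offAnnuli_of_coord he (border_eq δ), rfl⟩)
        · exact absurd rfl h
        · exact absurd rfl h
      · exact .inr (outer_closed s x y hx h)
    rcases CellComplex.mem_of_reflTransGen (X := G.collarWithHandles s) hC h hf with h | h
    · exact h
    · exact absurd h hx
  · rintro (⟨a, ha, rfl⟩ | ⟨i, δ, rfl⟩)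
    · obtain ⟨f, hf, hd, h⟩ := exists_face_reflTransGen s a ha
      refine ⟨⟨HCell.collar f 0, ?_, (collar_total_eq_one_iff s f hd).2 hf, ?_⟩, ?_⟩
      · change G.sDim f + 0 = 2
        rw [hd]
      · exact h.lift (fun a => (HCell.collar a 0 : G.HCell s)) fun a b h =>
          (hMult_collar_same s a b 0).trans_ne h.sMult_ne_zero
      · rintro ⟨b, hb⟩
        cases hb
    · refine ⟨⟨HCell.disc i δ, rfl, disc_total s i δ, .refl⟩, ?_⟩
      rintro ⟨b, hb⟩
      cases hb

/-! ### The Euler characteristic -/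

/-- The cells of the open annuli: the cells of a divided interval times those of the edges and the
squares at their starts. -/
def annulusCell (s : PM) : G.Edge s × Option (Fin 5) × Fin 3 → G.SCell
  | (e, none, t) => .ribbon s e (Fin.castLE (by decide) t.succ)
  | (e, some a, t) => G.square s e a (Fin.castLE (by decide) t.succ)

theorem annulusCell_injective (s : PM) : Function.Injective (annulusCell s : _ → G.SCell) := by
  rintro ⟨e, _ | a, t⟩ ⟨e', _ | a', t'⟩ h
  · simp only [annulusCell, SCell.ribbon.injEq, heq_eq_eq, true_and] at h
    obtain ⟨rfl, h⟩ := h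
    simpa [Fin.ext_iff] using h
  · exact absurd h.symm (square_ne_ribbon _ _ _ _ _ _ _)
  · exact absurd h (square_ne_ribbon _ _ _ _ _ _ _)
  · obtain ⟨rfl, rfl, h'⟩ := square_injective s h
    have ht : t = t' := by simpa [Fin.ext_iff] using h'
    rw [ht]

theorem range_annulusCell (s : PM) :
    Set.range (annulusCell s : _ → G.SCell) = ((offAnnuli s)ᶜ : Set G.SCell) := by
  have h1 : ∀ t : Fin 3, ¬ (Fin.castLE (by decide : 4 ≤ 5) t.succ = 0 ∨
      Fin.castLE (by decide : 4 ≤ 5) t.succ = 4) := by decide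
  have h2 : ∀ t : Fin 5, ¬ (t = 0 ∨ t = 4) →
      ∃ t' : Fin 3, Fin.castLE (by decide : 4 ≤ 5) t'.succ = t := by decide
  ext a
  constructor
  · rintro ⟨⟨e, _ | p, t⟩, rfl⟩ h
    · exact h1 t (h _ _ (coord_ribbon s e _))
    · exact h1 t (h _ _ (coord_square s e p _))
  · intro h
    obtain ⟨e, t, he, ht⟩ := exists_coord_of_notMem h
    obtain ⟨t, rfl⟩ := h2 t ht
    rcases eq_of_coord he with rfl | ⟨p, rfl⟩
    · exact ⟨(e, none, t), rfl⟩
    · exact ⟨(e, some p, t), rfl⟩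

/-- The factor along the circle vanishes for each edge: `3 - 2` for the divided interval of its
square and `-1` for its ribbon. -/
theorem eulerChar_compl_offAnnuli (s : PM) :
    G.surface.eulerChar (offAnnuli s)ᶜ = 0 := by
  have := Fintype.ofFinite (G.Edge s)
  have hsum : ∀ e : G.Edge s, ∑ x : Option (Fin 5) × Fin 3,
      (-1 : ℤ) ^ G.sDim (annulusCell s (e, x)) = 0 := by
    intro e
    have hr : ∀ t : Fin 5, G.sDim (.ribbon s e t) = 1 + segDim t := fun _ => rfl
    rw [Fintype.sum_prod_type, Fintype.sum_option]
    simp only [annulusCell, sDim_square, hr]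
    decide
  unfold CellComplex.eulerChar
  rw [show (offAnnuli s)ᶜ = Set.range (annulusCell s : _ → G.SCell) from (range_annulusCell s).symm]
  refine (finsum_mem_range (f := fun a : G.SCell => (-1 : ℤ) ^ G.sDim a)
    (annulusCell_injective s)).trans ?_
  rw [finsum_eq_sum_of_fintype, Fintype.sum_prod_type]
  exact Finset.sum_eq_zero fun e _ => hsum e

theorem eulerChar_unfilledInnerBoundary (s : PM) :
    (G.collarWithHandles s).eulerChar (G.unfilledInnerBoundary s) =
      G.surface.eulerChar Set.univ + 2 * G.g s := by
  have hU : G.unfilledInnerBoundary s =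
      ((fun a => HCell.collar a 0) '' (offAnnuli s : Set G.SCell) ∪
        Set.range fun x : Fin (G.g s) × LR => HCell.disc x.1 x.2 : Set (G.HCell s)) := by
    ext x
    rw [show x ∈ G.unfilledInnerBoundary s ↔ _ from mem_unfilledInnerBoundary_iff]
    constructor
    · rintro (⟨a, ha, rfl⟩ | ⟨i, δ, rfl⟩)
      · exact .inl ⟨a, ha, rfl⟩
      · exact .inr ⟨(i, δ), rfl⟩
    · rintro (⟨a, ha, rfl⟩ | ⟨⟨i, δ⟩, rfl⟩)
      · exact .inl ⟨a, ha, rfl⟩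
      · exact .inr ⟨i, δ, rfl⟩
  have hS : G.surface.eulerChar Set.univ = G.surface.eulerChar (offAnnuli s) := by
    rw [← Set.union_compl_self (offAnnuli s), CellComplex.eulerChar_union disjoint_compl_right,
      eulerChar_compl_offAnnuli, add_zero]
  have hC : (G.collarWithHandles s).eulerChar
      ((fun a => HCell.collar a 0) '' (offAnnuli s : Set G.SCell) : Set (G.HCell s)) =
      G.surface.eulerChar (offAnnuli s) :=
    CellComplex.eulerChar_image (X := G.surface) (Y := G.collarWithHandles s)
      (f := fun a => HCell.collar a 0) (fun a b h => by cases h; rfl) (fun _ => rfl) _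
  have hD : (G.collarWithHandles s).eulerChar
      (Set.range fun x : Fin (G.g s) × LR => HCell.disc x.1 x.2 : Set (G.HCell s)) =
      2 * G.g s := by
    have hLR : Nat.card LR = 2 := by
      have e : LR ≃ Bool := ⟨fun | .left => true | .right => false,
        fun | true => .left | false => .right, by rintro (_ | _) <;> rfl,
        by rintro (_ | _) <;> rfl⟩
      rw [Nat.card_congr e]
      simp
    unfold CellComplex.eulerChar
    refine (finsum_mem_range (f := fun a : G.HCell s => (-1 : ℤ) ^ G.hDim s a) ?_).trans ?_
    · rintro ⟨i, δ⟩ ⟨j, δ'⟩ h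
      cases h
      rfl
    · have := Fintype.ofFinite (Fin (G.g s) × LR)
      rw [finsum_eq_sum_of_fintype]
      have : Fintype.card (Fin (G.g s) × LR) = G.g s * 2 := by
        rw [← Nat.card_eq_fintype_card, Nat.card_prod, hLR, Nat.card_fin]
      simp [hDim, this, mul_comm]
  rw [hS, ← hC, ← hD, hU]
  refine CellComplex.eulerChar_union (X := G.collarWithHandles s) (Set.disjoint_left.2 ?_)
  rintro _ ⟨a, -, rfl⟩ ⟨x, hx⟩
  cases hx

/-! ### The components -/

theorem exists_circleOf_eq (s : PM) (i : Fin (G.g s)) : ∃ e, G.circleOf s e = i := by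
  by_cases h : ∀ h, G.circ s h ≠ i
  · exact ⟨.inr ⟨i, h⟩, rfl⟩
  · push Not at h
    obtain ⟨k, hk⟩ := h
    exact ⟨.inl k, hk⟩

/-- By `circ_eq_iff` the ends on one circle form a single orbit of `next`, each step of which keeps
the region. So the region of a capping disc does not depend on the edge chosen for it. -/
theorem sideRegion_eq_of_circleOf_eq (s : PM) {e e' : G.Edge s} (δ : LR)
    (h : G.circleOf s e = G.circleOf s e') :
    sideRegion s (⟨s, e, δ⟩ : G.Side) = sideRegion s ⟨s, e', δ⟩ := by
  rcases e with k | x <;> rcases e' with k' | x'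
  · obtain ⟨n, -, hn⟩ := ((G.circ_eq_iff s k k').1 h).exists_pow_eq'
    have : ∀ n : ℕ, sideRegion s (⟨s, .inl ((G.next s ^ n) k), δ⟩ : G.Side) =
        sideRegion s ⟨s, .inl k, δ⟩ := by
      intro n
      induction n with
      | zero => rfl
      | succ n ih =>
        rw [pow_succ', Equiv.Perm.mul_apply]
        exact (sideRegion_nextEdge s (.inl ((G.next s ^ n) k)) δ).trans ih
    rw [← hn, this]
  · exact absurd h (x'.2 k)
  · exact absurd h.symm (x.2 k')
  · rw [Subtype.ext (show x.1 = x'.1 from h)]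

/-- The component of the color graph that belongs to a cell of the inner boundary. -/
noncomputable def handleRegion (s : PM) : G.HCell s → (G.colorGraph s).ConnectedComponent
  | .collar a _ => region s a
  | .disc i δ => sideRegion s ⟨s, (exists_circleOf_eq s i).choose, δ⟩
  -- An arbitrary value: handles do not lie in the inner boundary.
  | .handle i => sideRegion s ⟨s, (exists_circleOf_eq s i).choose, .left⟩

theorem collar_mem_unfilledInnerBoundary {s : PM} {a : G.SCell}
    (ha : a ∈ (offAnnuli s : Set G.SCell)) :
    (HCell.collar a 0 : G.HCell s) ∈ (G.unfilledInnerBoundary s : Set (G.HCell s)) :=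
  mem_unfilledInnerBoundary_iff.2 (.inl ⟨a, ha, rfl⟩)

/-- The discs neither merge nor add components: `region` extends over them, and each meets the
border of a ribbon of its circle. -/
theorem card_component_unfilledInnerBoundary (s : PM) :
    Nat.card ((G.collarWithHandles s).Component (G.unfilledInnerBoundary s)) = G.k s := by
  have hmap : ∀ {a b : G.SCell} (h : Joined s a b),
      ∃ (ha : (HCell.collar a 0 : G.HCell s) ∈ (G.unfilledInnerBoundary s : Set (G.HCell s)))
        (hb : (HCell.collar b 0 : G.HCell s) ∈ (G.unfilledInnerBoundary s : Set (G.HCell s))),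
        (G.collarWithHandles s).componentOf (G.unfilledInnerBoundary s) ⟨_, ha⟩ =
          (G.collarWithHandles s).componentOf (G.unfilledInnerBoundary s) ⟨_, hb⟩ :=
    fun h => h.map (Y := G.collarWithHandles s) (fun a => HCell.collar a 0)
      (fun _ => collar_mem_unfilledInnerBoundary)
      fun a b h => (hMult_collar_same s a b 0).trans_ne h
  have hne : ∀ {a : G.SCell}, a ∈ (offAnnuli s : Set G.SCell) → ∀ e, coord s a ≠ some (e, 2) := by
    intro a ha e he
    rcases ha e 2 he with h | h <;> exact absurd h (by decide)
  obtain ⟨f, -⟩ := CellComplex.exists_equiv_connectedComponent (X := G.collarWithHandles s)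
    (A := G.unfilledInnerBoundary s) (G.colorGraph s) (handleRegion s)
    (fun c => ⟨HCell.collar (.face c) 0, collar_mem_unfilledInnerBoundary (face_mem_offAnnuli s c)⟩)
    (by
      intro x hx y hy h
      rcases mem_unfilledInnerBoundary_iff.1 hx with ⟨a, ha, rfl⟩ | ⟨i, δ, rfl⟩ <;>
        rcases mem_unfilledInnerBoundary_iff.1 hy with ⟨b, hb, rfl⟩ | ⟨j, δ', rfl⟩
      · rcases hMult_collar_ne_zero (s := s) h with ⟨-, h⟩ | ⟨-, h⟩
        · exact h.region_eq (hne ha) (hne hb)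
        · exact absurd (segMult_self _) h
      · exact absurd rfl h
      · obtain ⟨-, -, e, hei, he⟩ := hMult_disc_ne_zero h
        refine Eq.trans ?_ (region_of_coord he).symm
        rw [sideAt_border]
        exact sideRegion_eq_of_circleOf_eq s δ ((exists_circleOf_eq s i).choose_spec.trans hei.symm)
      · exact absurd rfl h)
    (region_face s)
    (fun p q h => (hmap (joined_face_of_adj s p q h)).choose_spec.choose_spec)
    (by
      have key : ∀ (a : G.SCell) (ha : a ∈ (offAnnuli s : Set G.SCell)), ∃ c,
          (G.collarWithHandles s).componentOf (G.unfilledInnerBoundary s)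
            ⟨HCell.collar a 0, collar_mem_unfilledInnerBoundary ha⟩ =
          (G.collarWithHandles s).componentOf (G.unfilledInnerBoundary s)
            ⟨HCell.collar (.face c) 0,
              collar_mem_unfilledInnerBoundary (face_mem_offAnnuli s c)⟩ := by
        intro a ha
        obtain ⟨c, hc⟩ := exists_joined_face s a ha
        exact ⟨c, (hmap hc).choose_spec.choose_spec.symm⟩
      rintro ⟨x, hx⟩
      rcases mem_unfilledInnerBoundary_iff.1 hx with ⟨a, ha, rfl⟩ | ⟨i, δ, rfl⟩
      · exact key a ha
      · obtain ⟨e, he⟩ := exists_circleOf_eq s i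
        have hcoord := coord_ribbon s e (border δ)
        obtain ⟨c, hc⟩ := key _ (mem_offAnnuli_of_coord hcoord (border_eq δ))
        refine ⟨c, Eq.trans (CellComplex.componentOf_eq (X := G.collarWithHandles s) _ _ ?_) hc⟩
        change G.hMult s (.disc i δ) (.collar (.ribbon s e (border δ)) 0) ≠ 0
        simp only [hMult]
        rw [if_pos ⟨rfl, by simp only [sDim, dim_border], atPosition_iff.2 ⟨e, he, hcoord⟩⟩]
        exact one_ne_zero)
  exact (Nat.card_congr f).symm

/-! ### The genus formula -/

theorem innerGenus_eq (s : PM) :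
    G.innerGenus s = (G.k s : ℚ) - (G.g s : ℚ) + G.surfaceGenus - 1 := by
  have h := CellComplex.finsum_genus_fillSpheres (X := G.collarWithHandles s)
    (O := Set.range fun a : G.SCell => HCell.collar a 2) (outer_closed s)
    (B := G.innerBoundary s) (by
      exact congrArg ((G.compressionBody s).boundary \ ·) (Set.range_comp Sum.inl
        fun a : G.SCell => (HCell.collar a 2 : G.HCell s)))
  -- The total genus is now `k^s - (χ(S(G)) + 2 g^s) / 2`, where `χ(S(G)) / 2 = 1 - g_S`.
  refine Eq.trans h ?_
  change (Nat.card ((G.collarWithHandles s).Component (G.unfilledInnerBoundary s)) : ℚ) -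
    ((G.collarWithHandles s).eulerChar (G.unfilledInnerBoundary s) : ℚ) / 2 = _
  rw [card_component_unfilledInnerBoundary, eulerChar_unfilledInnerBoundary, surfaceGenus,
    CellComplex.genus]
  push_cast
  ring

end DecoratedGaussDiagram

theorem mainTheorem4 (G : DecoratedGaussDiagram) (s : PM) :
    G.innerGenus s = (G.k s : ℚ) - (G.g s : ℚ) + G.surfaceGenus - 1 ∧
    ∃ f : (G.colorGraph s).ConnectedComponent ≃ G.surface.Component (G.curves s)ᶜ,
      ∀ c : Fin G.m, f ((G.colorGraph s).connectedComponentMk c) =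
        G.surface.componentOf (G.curves s)ᶜ ⟨.face c, G.face_mem_compl_curves s c⟩ :=
  ⟨DecoratedGaussDiagram.innerGenus_eq s,
    DecoratedGaussDiagram.exists_equiv_component_compl_curves s⟩
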